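/- Let $G=(V,E)$ be a finite simple graph and let $b_i\ge 1$ be an integer for each agent $i\in V$. An (integral) b-matching is a symmetric array $\mu=(\mu_{ij})$ of nonnegative integers with $\mu_{ij}=0$ unless $ij\in E$, and with utilities $u_i(\mu)=\sum_j\mu_{ij}\le b_i$; it is maximum if $\sum_i u_i(\mu)$ is largest. Let $V^U$ be the set of agents $i$ with $u_i(\mu)<b_i$ for some maximum b-matching $\mu$, and $V^O$ the set of agents outside $V^U$ with a neighbour in $V^U$. The transformed bipartite network $N$ has on its left a node $a_i$ with supply $b_i$ for each $i\in V$. On its right it has a node $c_i$ with demand $b_i$ for each $i\notin V^U$, a node $c'_j$ with demand $b_j$ for each $j\in V^O$, and, for each connected component $C$ of $G[V^U]$ with at least two vertices and $\sum_{i\in C}b_i$ odd, a node $B^C$ with demand $\sum_{i\in C}b_i-1$. Its arcs, of infinite capacity, are $a_ic_i$ for $i\notin V^U$; $a_ic'_j$ for $i\in V^U$, $j\in V^O$, $ij\in E$; and $a_iB^C$ for $i\in C$. A flow assigns a nonnegative real number to each arc so that no supply or demand is exceeded; it is maximum if its total value is largest. Write $x_i(f)$ for the amount shipped from $a_i$ by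 a flow $f$. The egalitarian allocation $x$ of the left nodes (supplies $s_i$, demands $d_j$) is defined recursively: among the remaining nodes, find the least $\lambda\ge 0$ for which some nonempty set $X$ of left nodes satisfies $\sum_{i\in X}\min(\lambda,s_i)=\sum_{j\in N(X)}d_j$, where $N(X)$ is the set of remaining right nodes linked to $X$; take the largest such $X$, set $x_i=\min(\lambda,s_i)$ for $i\in X$, remove $X$ and $N(X)$, and continue; if there is no such $\lambda$, set $x_i=s_i$ for all remaining $i$. An egalitarian maximum flow is a maximum flow $f$ for which $(x_i(f))_i$ is the egalitarian allocation. Then: 1. The egalitarian allocation exists and is unique, and an egalitarian maximum flow exists on $N$. 2. Every extreme point of the polytope of maximum flows on $N$ is integral. 3. To every integral maximum flow $F$ on $N$ there corresponds a maximum b-matching $\mu$ of $G$, in the sense that $u_i(\mu)=x_i(F)$ for all $i\in V$, and $\mu_{ij}$ is the flow of $F$ from $a_i$ to $c'_j$ for all $i\in V^U$, $j\in V^O$ (this flow being $0$ if $ij\notin E$). 4. Let $f$ be an egalitarian maximum flow, and consider the linear program in variables $w_F$, indexed by the integral extreme points $F$ of the polytope of maximum flows, with the constraints $w\ge 0$,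 $\sum_F w_F=1$, $\sum_F w_F F=f$ and an arbitrary linear objective. It has an optimal solution. Every optimal solution $w$ writes $f$ as a convex combination of integral maximum flows. Moreover, a maximum b-matching $\mu_F$ corresponding to $F$ can be chosen for every $F$, and for every such choice, picking $\mu_F$ with probability $w_F$ is a lottery over maximum b-matchings of $G$ in which the expected utility of every agent $i$ equals $x_i(f)$. -/

import Mathlib

/-- A finite linear program in standard form,
minimise `cost ⬝ x` subject to `A x = rhs`, `x ≥ 0`. -/
structure LinearProgram (m n : Type*) where
  A : Matrix m n ℝ
  rhs : m → ℝ
  cost : n → ℝ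

namespace LinearProgram

variable {m n : Type*} [Fintype n]

/-- `x` satisfies the constraints of the linear program. -/
def IsFeasible (L : LinearProgram m n) (x : n → ℝ) : Prop :=
  L.A.mulVec x = L.rhs ∧ ∀ k, 0 ≤ x k

/-- `x` is an optimal solution of the linear program. -/
def IsOptimal (L : LinearProgram m n) (x : n → ℝ) : Prop :=
  L.IsFeasible x ∧ ∀ y, L.IsFeasible y → L.cost ⬝ᵥ x ≤ L.cost ⬝ᵥ y

end LinearProgram

/-- A two-sided flow network: a source joined to each `i : S` by an arc of capacity `supply i`,
arcs of infinite capacity from `i : S` to `j : D` whenever `link i j`, and each `j : D` joined to a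
sink by an arc of capacity `demand j`. -/
structure BipartiteNetwork (S D : Type*) where
  supply : S → ℕ
  demand : D → ℕ
  link : S → D → Prop

namespace BipartiteNetwork

variable {S D : Type*} [Fintype S] [Fintype D] (N : BipartiteNetwork S D)

/-- The amount shipped by `i`, that is, the flow on the arc from the source to `i`. -/
def outflow (f : S → D → ℝ) (i : S) : ℝ := ∑ j, f i j

/-- The amount received by `j`, that is, the flow on the arc from `j` to the sink. -/
def inflow (f : S → D → ℝ) (j : D) : ℝ := ∑ i, f i j

/-- The value of a flow. -/
def flowValue (f : S → D → ℝ) : ℝ := ∑ i, outflow f i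

/-- A feasible (fractional) flow, given by its values on the middle arcs; the flow on the source
and sink arcs is determined by conservation. -/
structure IsFlow (f : S → D → ℝ) : Prop where
  nonneg : ∀ i j, 0 ≤ f i j
  eq_zero : ∀ i j, ¬ N.link i j → f i j = 0
  outflow_le : ∀ i, outflow f i ≤ N.supply i
  inflow_le : ∀ j, inflow f j ≤ N.demand j

/-- A maximum flow. -/
def IsMaxFlow (f : S → D → ℝ) : Prop :=
  N.IsFlow f ∧ ∀ g, N.IsFlow g → flowValue g ≤ flowValue f

/-- The polytope of maximum flows. -/
def maxFlowPolytope : Set (S → D → ℝ) := {f | N.IsMaxFlow f}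

/-- A nonnegative integral assignment, read as a real one. -/
def toReal (F : S → D → ℕ) : S → D → ℝ := fun i j => (F i j : ℝ)

theorem toReal_le_supply {F : S → D → ℕ} {i : S} (h : outflow (toReal F) i ≤ N.supply i) (j : D) :
    F i j ≤ N.supply i := by
  have h1 : toReal F i j ≤ outflow (toReal F) i :=
    Finset.single_le_sum (f := fun j => toReal F i j)
      (fun j _ => Nat.cast_nonneg (F i j)) (Finset.mem_univ j)
  have h2 : ((F i j : ℕ) : ℝ) ≤ N.supply i := h1.trans h
  exact_mod_cast h2

/-- The integral extreme points of the polytope of maximum flows. -/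
abbrev ExtremeFlow : Type _ :=
  {F : S → D → ℕ // toReal F ∈ Set.extremePoints ℝ N.maxFlowPolytope}

instance : Finite N.ExtremeFlow := by
  classical
  refine Set.Finite.to_subtype (Set.Finite.subset
    (Set.finite_Icc (0 : S → D → ℕ) (fun i _ => N.supply i)) ?_)
  intro F hF
  refine ⟨fun i j => Nat.zero_le _, fun i j => ?_⟩
  exact N.toReal_le_supply ((hF.1 : N.IsMaxFlow (toReal F)).1.outflow_le i) j

noncomputable instance : Fintype N.ExtremeFlow := Fintype.ofFinite _

/-- The linear program in the weights `w F` of the extreme points `F` of the polytope of maximum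
flows, with constraints `∑ F, w F = 1`, `∑ F, w F * F i j = f i j` for all `i, j`, `w ≥ 0`, and
with the objective `c`. -/
def decompositionLP (f : S → D → ℝ) (c : N.ExtremeFlow → ℝ) :
    LinearProgram (Option (S × D)) N.ExtremeFlow where
  A := fun r F => r.elim 1 (fun e => toReal F.1 e.1 e.2)
  rhs := fun r => r.elim 1 (fun e => f e.1 e.2)
  cost := c

open scoped Classical in
/-- The demand nodes in `T` that are linked to some member of `X`. -/
noncomputable def neighbors (T : Finset D) (X : Finset S) : Finset D :=
  T.filter (fun j => ∃ i ∈ X, N.link i j)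

/-- In the subproblem on the supply nodes `R` and the demand nodes `T`, the nonempty set `X` is a
bottleneck when each supply `s i` is cut down to `min t (s i)`: its members together send exactly
the total demand of the nodes they are linked to. -/
def IsBottleneck (R : Finset S) (T : Finset D) (t : ℝ) (X : Finset S) : Prop :=
  X.Nonempty ∧ X ⊆ R ∧
    ∑ i ∈ X, min t (N.supply i : ℝ) = ∑ j ∈ N.neighbors T X, (N.demand j : ℝ)

/-- `X` is the largest bottleneck set at the first level `t ≥ 0` at which a bottleneck occurs. -/
structure IsFirstBottleneck (R : Finset S) (T : Finset D) (t : ℝ) (X : Finset S) : Prop where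
  level_nonneg : 0 ≤ t
  isBottleneck : N.IsBottleneck R T t X
  first : ∀ t' Y, 0 ≤ t' → t' < t → ¬ N.IsBottleneck R T t' Y
  largest : ∀ Y, N.IsBottleneck R T t Y → Y ⊆ X

open scoped Classical in
/-- The egalitarian procedure on the subproblem with supply nodes `R` and demand nodes `T`:
if no bottleneck ever occurs, then every supply node ships its full supply; otherwise the largest
set `X` at the first bottleneck level `t` gets `min t (s i)`, and the procedure continues on what
remains after `X` and the demand nodes linked to `X` have been removed. -/
inductive EgalitarianOn (x : S → ℝ) : Finset S → Finset D → Prop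
  | done (R : Finset S) (T : Finset D)
      (none_left : ∀ t X, 0 ≤ t → ¬ N.IsBottleneck R T t X)
      (value : ∀ i ∈ R, x i = N.supply i) : EgalitarianOn x R T
  | step (R : Finset S) (T : Finset D) (t : ℝ) (X : Finset S)
      (bottleneck : N.IsFirstBottleneck R T t X)
      (value : ∀ i ∈ X, x i = min t (N.supply i : ℝ))
      (rest : EgalitarianOn x (R \ X) (T \ N.neighbors T X)) : EgalitarianOn x R T

/-- `x` is the egalitarian allocation of the supply nodes. -/
def IsEgalitarianAllocation (x : S → ℝ) : Prop :=
  N.EgalitarianOn x Finset.univ Finset.univ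

/-- An egalitarian maximum flow: a maximum flow that induces the egalitarian allocation. -/
def IsEgalitarianMaxFlow (f : S → D → ℝ) : Prop :=
  N.IsMaxFlow f ∧ N.IsEgalitarianAllocation (outflow f)

end BipartiteNetwork

namespace BMatching

variable {V : Type*} [Fintype V]

/-- The utility of the agent `i` under `μ`: the number of units that `i` exchanges. -/
def utility (μ : V → V → ℕ) (i : V) : ℕ := ∑ j, μ i j

/-- An integral b-matching: `μ i j` units are exchanged between `i` and `j`. -/
structure IsBMatching (G : SimpleGraph V) (b : V → ℕ) (μ : V → V → ℕ) : Prop where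
  symm : ∀ i j, μ i j = μ j i
  eq_zero : ∀ i j, ¬ G.Adj i j → μ i j = 0
  utility_le : ∀ i, utility μ i ≤ b i

/-- A maximum b-matching: one with the largest total utility. -/
def IsMaxBMatching (G : SimpleGraph V) (b : V → ℕ) (μ : V → V → ℕ) : Prop :=
  IsBMatching G b μ ∧ ∀ ν, IsBMatching G b ν → ∑ i, utility ν i ≤ ∑ i, utility μ i

/-- The set of maximum b-matchings. -/
abbrev MaxBMatching (G : SimpleGraph V) (b : V → ℕ) : Type _ :=
  {μ : V → V → ℕ // IsMaxBMatching G b μ}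

instance (G : SimpleGraph V) (b : V → ℕ) : Finite (MaxBMatching G b) := by
  classical
  refine Set.Finite.to_subtype (Set.Finite.subset
    (Set.finite_Icc (0 : V → V → ℕ) (fun i _ => b i)) ?_)
  intro μ hμ
  refine ⟨fun i j => Nat.zero_le _, fun i j => ?_⟩
  exact (Finset.single_le_sum (f := fun j => μ i j) (fun j _ => Nat.zero_le _)
    (Finset.mem_univ j)).trans (hμ.1.utility_le i)

noncomputable instance (G : SimpleGraph V) (b : V → ℕ) : Fintype (MaxBMatching G b) :=
  Fintype.ofFinite _

/-- A lottery over maximum b-matchings: a probability distribution on that finite set. -/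
def IsLottery {G : SimpleGraph V} {b : V → ℕ} (P : MaxBMatching G b → ℝ) : Prop :=
  (∀ μ, 0 ≤ P μ) ∧ ∑ μ, P μ = 1

/-- The utility of the agent `i` under a lottery: the expected number of units exchanged. -/
noncomputable def lotteryUtility {G : SimpleGraph V} {b : V → ℕ} (P : MaxBMatching G b → ℝ)
    (i : V) : ℝ :=
  ∑ μ, P μ * (utility μ.1 i : ℝ)

/-- The underdemanded agents: those left unsaturated by some maximum b-matching. -/
def underdemanded (G : SimpleGraph V) (b : V → ℕ) : Set V :=
  {i | ∃ μ, IsMaxBMatching G b μ ∧ utility μ i < b i}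

/-- The overdemanded agents: those saturated by every maximum b-matching and adjacent to some
underdemanded agent. -/
def overdemanded (G : SimpleGraph V) (b : V → ℕ) : Set V :=
  {i | i ∉ underdemanded G b ∧ ∃ j ∈ underdemanded G b, G.Adj i j}

/-- The connected components of the subgraph induced on the underdemanded agents. -/
abbrev UComponent (G : SimpleGraph V) (b : V → ℕ) : Type _ :=
  (G.induce (underdemanded G b)).ConnectedComponent

open scoped Classical in
/-- The total number of units available in a component. -/
noncomputable def componentDemand {G : SimpleGraph V} {b : V → ℕ} (C : UComponent G b) : ℕ :=
  ∑ i : underdemanded G b with (G.induce (underdemanded G b)).connectedComponentMk i = C, b i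

/-- The nodes on the right of the transformed network:
* one node for each agent that is not underdemanded (perfectly demanded or overdemanded);
* one more node for each overdemanded agent;
* one node for each odd component with at least two agents. A component is odd if it has an odd
  total number of units (an odd number of nodes once each agent `i` is split into `b i` unit
  copies). -/
abbrev SinkNode (G : SimpleGraph V) (b : V → ℕ) : Type _ :=
  {i : V // i ∉ underdemanded G b} ⊕ {j : V // j ∈ overdemanded G b} ⊕
    {C : UComponent G b // C.supp.Nontrivial ∧ Odd (componentDemand C)}

instance (G : SimpleGraph V) (b : V → ℕ) : Finite (UComponent G b) :=
  Quot.finite _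

noncomputable instance (G : SimpleGraph V) (b : V → ℕ) : Fintype (SinkNode G b) :=
  Fintype.ofFinite _

/-- The transformed bipartite network. Its left nodes are the agents, with supply `b i`. An agent
that is not underdemanded is linked to its own node only; an underdemanded agent is linked to the
extra nodes of its overdemanded neighbours and to the node of its component, if there is one. -/
noncomputable def transformedNetwork (G : SimpleGraph V) (b : V → ℕ) :
    BipartiteNetwork V (SinkNode G b) where
  supply := b
  demand
    | .inl i => b i
    | .inr (.inl j) => b j
    | .inr (.inr C) => componentDemand C.1 - 1
  link i
    | .inl k => i = k
    | .inr (.inl j) => i ∈ underdemanded G b ∧ G.Adj i j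
    | .inr (.inr C) => ∃ h : i ∈ underdemanded G b,
        (G.induce (underdemanded G b)).connectedComponentMk ⟨i, h⟩ = C.1

/-- An integral flow `F` on the transformed network corresponds to the b-matching `μ`: every agent
exchanges under `μ` as many units as it ships under `F`, and an underdemanded agent `i` exchanges
with an overdemanded agent `j` what it ships to the extra node of `j`. -/
structure Corresponds {G : SimpleGraph V} {b : V → ℕ} (F : V → SinkNode G b → ℕ)
    (μ : V → V → ℕ) : Prop where
  utility_eq : ∀ i, utility μ i = ∑ k, F i k
  exchange_eq : ∀ i ∈ underdemanded G b, ∀ j : {j : V // j ∈ overdemanded G b},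
    μ i j = F i (.inr (.inl j))

open scoped Classical in
/-- The distribution on maximum b-matchings obtained from weights `w` on extreme flows when each
extreme flow `F` is replaced by the maximum b-matching `m F`. -/
noncomputable def inducedLottery {G : SimpleGraph V} {b : V → ℕ}
    (m : (transformedNetwork G b).ExtremeFlow → MaxBMatching G b)
    (w : (transformedNetwork G b).ExtremeFlow → ℝ) (μ : MaxBMatching G b) : ℝ :=
  ∑ F with m F = μ, w F

end BMatching

/-! ### Gallai–Edmonds structure of maximum b-matchings, by alternating walks -/

section GallaiEdmonds

open scoped Classical

namespace BMatching

/-! The graph enters only through a dictionary between integral maximum flows and maximum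
b-matchings; the statements on allocations, extreme points and the linear program hold for every
bipartite network with integral supplies and demands.

The dictionary rests on the Gallai–Edmonds structure. Following an alternating walk in the
difference of two arrays (`IsEdgeArray.exchange`) lets a unit at an agent missed by some maximum
b-matching be moved to an underdemanded agent (`IsBMatching.exists_shift`). Hence overdemanded
agents exchange with underdemanded ones only, and deleting them leaves a b-matching that is maximum
for what remains. Gallai's lemma (`IsMaxBMatching.not_two_missed`), applied to the remainder, shows
that the exchanges inside a nontrivial component of the underdemanded agents miss at most one unit;
that unit can be at any prescribed vertex, and parity makes the component odd.

Read as a flow, a maximum b-matching therefore meets every demand of the network, so every integral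
maximum flow does too (`inflow_eq_demand`). Conversely, such a flow leaves exactly one unit of each
nontrivial component out of its component node, and a near-perfect array realises this. Adding the
exchanges with overdemanded agents, and a fixed maximum b-matching on the agents that are neither
under- nor overdemanded, gives the required b-matching (`exists_corresponds`).

On the flow side, minimality of each bottleneck level is Hall's condition, so the egalitarian
allocation can be shipped; tightness of the bottleneck makes it maximum. An extreme flow with a
nonintegral entry could be perturbed both ways along a circulation on its nonintegral arcs. A
maximum flow is then a convex combination of the finitely many extreme ones by Krein–Milman, the
weights range over a compact set, and expected utilities follow by linearity. -/

/-- A symmetric array of nonnegative integers supported on the edges of `G`. -/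
structure IsEdgeArray {V : Type*} (G : SimpleGraph V) (μ : V → V → ℕ) : Prop where
  symm : ∀ i j, μ i j = μ j i
  eq_zero : ∀ i j, ¬ G.Adj i j → μ i j = 0

namespace IsEdgeArray

variable {V : Type*} {G : SimpleGraph V} {μ ν : V → V → ℕ}

theorem adj (hμ : IsEdgeArray G μ) {i j : V} (h : 0 < μ i j) : G.Adj i j := by
  by_contra hn
  have := hμ.eq_zero i j hn
  omega

theorem zero : IsEdgeArray G (fun _ _ => 0) := ⟨fun _ _ => rfl, fun _ _ _ => rfl⟩

theorem add (hμ : IsEdgeArray G μ) (hν : IsEdgeArray G ν) :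
    IsEdgeArray G (fun i j => μ i j + ν i j) :=
  ⟨fun i j => by simp only [hμ.symm i j, hν.symm i j],
    fun i j h => by simp only [hμ.eq_zero i j h, hν.eq_zero i j h]⟩

theorem sum {ι : Type*} {s : Finset ι} {κ : ι → V → V → ℕ} (h : ∀ c, IsEdgeArray G (κ c)) :
    IsEdgeArray G (fun i j => ∑ c ∈ s, κ c i j) :=
  ⟨fun i j => Finset.sum_congr rfl fun c _ => (h c).symm i j,
    fun i j hij => Finset.sum_eq_zero fun c _ => (h c).eq_zero i j hij⟩

end IsEdgeArray

/-- The restriction of an array to the pairs inside a set. -/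
noncomputable def restrict {V : Type*} (s : Set V) (μ : V → V → ℕ) : V → V → ℕ :=
  fun i j => if i ∈ s ∧ j ∈ s then μ i j else 0

theorem IsEdgeArray.isEdgeArray_restrict {V : Type*} {G : SimpleGraph V} {μ : V → V → ℕ}
    (hμ : IsEdgeArray G μ) (s : Set V) : IsEdgeArray G (restrict s μ) := by
  refine ⟨fun i j => ?_, fun i j h => ?_⟩
  · simp only [restrict, hμ.symm i j, and_comm]
  · simp only [restrict, hμ.eq_zero i j h, ite_self]

/-- The array with a single unit on the pair `v, y`. -/
noncomputable def unitEdge {V : Type*} (v y : V) : V → V → ℕ :=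
  fun i j => if (i = v ∧ j = y) ∨ (i = y ∧ j = v) then 1 else 0

variable {V : Type*} [Fintype V] {G : SimpleGraph V} {b : V → ℕ} {μ ν : V → V → ℕ}

/-- One unit at the vertex `v`. -/
noncomputable def unit {V : Type*} (v : V) : V → ℕ := Pi.single v 1

@[simp]
theorem unit_self {V : Type*} (v : V) : unit v v = 1 := by simp [unit]

theorem unit_of_ne {V : Type*} {v i : V} (h : i ≠ v) : unit v i = 0 := by simp [unit, h]

theorem unit_eq_one_or {V : Type*} (v i : V) : (i = v ∧ unit v i = 1) ∨ (i ≠ v ∧ unit v i = 0) := by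
  by_cases h : i = v
  · subst h; simp
  · simp [h, unit]

theorem sum_unit_filter (v : V) (p : V → Prop) :
    ∑ i with p i, unit v i = if p v then 1 else 0 := by
  simp [unit, Pi.single_apply]

theorem sum_unit (v : V) : ∑ i, unit v i = 1 := by simp [unit]

theorem utility_unitEdge {v y : V} (h : v ≠ y) (i : V) :
    utility (unitEdge v y) i = unit v i + unit y i := by
  unfold utility unitEdge unit
  by_cases hv : i = v
  · subst hv
    simp [h]
  · by_cases hy : i = y
    · subst hy
      simp [Ne.symm h]
    · simp [hv, hy]

theorem utility_add (μ ν : V → V → ℕ) (i : V) :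
    utility (fun i j => μ i j + ν i j) i = utility μ i + utility ν i :=
  Finset.sum_add_distrib

theorem utility_restrict_le (s : Set V) (μ : V → V → ℕ) (i : V) :
    utility (restrict s μ) i ≤ utility μ i :=
  Finset.sum_le_sum fun j _ => by unfold restrict; split_ifs <;> simp

theorem utility_restrict_of_notMem {s : Set V} {i : V} (h : i ∉ s) :
    utility (restrict s μ) i = 0 :=
  Finset.sum_eq_zero fun j _ => by simp [restrict, h]

theorem isEdgeArray_unitEdge {V : Type*} {G : SimpleGraph V} {v y : V} (h : G.Adj v y) :
    IsEdgeArray G (unitEdge v y) := by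
  refine ⟨fun i j => ?_, fun i j hij => ?_⟩
  · unfold unitEdge
    congr 1
    simp only [eq_iff_iff]
    tauto
  · unfold unitEdge
    rw [if_neg]
    rintro (⟨rfl, rfl⟩ | ⟨rfl, rfl⟩)
    exacts [hij h, hij h.symm]

theorem IsEdgeArray.exists_add_edge (hμ : IsEdgeArray G μ) {v y : V} (h : G.Adj v y) :
    ∃ μ', IsEdgeArray G μ' ∧ ∀ i, utility μ' i = utility μ i + unit v i + unit y i :=
  ⟨_, hμ.add (isEdgeArray_unitEdge h), fun i => by
    rw [utility_add, utility_unitEdge h.ne, add_assoc]⟩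

theorem IsEdgeArray.exists_sub_edge (hμ : IsEdgeArray G μ) {v y : V} (h : 0 < μ v y) :
    ∃ μ', IsEdgeArray G μ' ∧ ∀ i, utility μ i = utility μ' i + unit v i + unit y i := by
  have hadj := hμ.adj h
  have hle : ∀ i j, unitEdge v y i j ≤ μ i j := by
    intro i j
    unfold unitEdge
    split_ifs with hc
    · rcases hc with ⟨rfl, rfl⟩ | ⟨rfl, rfl⟩
      · exact h
      · rw [hμ.symm]; exact h
    · exact Nat.zero_le _
  refine ⟨fun i j => μ i j - unitEdge v y i j, ⟨fun i j => ?_, fun i j hij => ?_⟩,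
    fun i => ?_⟩
  · simp only [hμ.symm i j, (isEdgeArray_unitEdge hadj).symm i j]
  · simp only [hμ.eq_zero i j hij, Nat.zero_sub]
  · rw [add_assoc, ← utility_unitEdge hadj.ne, ← utility_add]
    exact Finset.sum_congr rfl fun j _ => (Nat.sub_add_cancel (hle i j)).symm

theorem exists_lt_of_utility_lt (h : utility ν v < utility μ v) : ∃ y, ν v y < μ v y := by
  by_contra! hn
  exact absurd (Finset.sum_le_sum fun y _ => hn y) (not_le.mpr h)

theorem sum_eq_of_units {p q : V → ℕ} {v w : V} (h : ∀ i, p i = q i + unit v i + unit w i) :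
    ∑ i, p i = ∑ i, q i + 2 := by
  rw [Finset.sum_congr rfl fun i _ => h i, Finset.sum_add_distrib, Finset.sum_add_distrib,
    sum_unit, sum_unit]

/-- The exchange property of symmetric arrays, obtained by following an alternating walk from `v`
in the difference of `μ` and `ν`. -/
theorem IsEdgeArray.exchange (hμ : IsEdgeArray G μ) (hν : IsEdgeArray G ν) {v : V}
    (h : utility ν v < utility μ v) :
    ∃ x, (∃ ν', IsEdgeArray G ν' ∧ utility ν x + unit v x < utility μ x ∧
        ∀ i, utility ν' i = utility ν i + unit v i + unit x i) ∨
      (utility μ x < utility ν x ∧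
        (∃ μ', IsEdgeArray G μ' ∧ ∀ i, utility μ' i + unit v i = utility μ i + unit x i) ∧
        ∃ ν', IsEdgeArray G ν' ∧ ∀ i, utility ν' i + unit x i = utility ν i + unit v i) := by
  induction hn : ∑ i, utility μ i using Nat.strong_induction_on generalizing μ ν v with
  | _ n ih =>
  obtain ⟨y, hy⟩ := exists_lt_of_utility_lt h
  have hvy : G.Adj v y := hμ.adj (by omega)
  obtain ⟨μ₁, hμ₁, hu₁⟩ := hμ.exists_sub_edge (v := v) (y := y) (by omega)
  by_cases hyy : utility ν y < utility μ y
  · obtain ⟨ν', hν', hu'⟩ := hν.exists_add_edge hvy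
    refine ⟨y, .inl ⟨ν', hν', ?_, hu'⟩⟩
    rw [unit_of_ne hvy.ne']
    exact hyy
  -- At `y` the array `ν` has at least the utility of `μ` but less on the pair `y, v`, so it has
  -- more on some other pair.
  obtain ⟨z, hz⟩ : ∃ z, μ y z < ν y z := by
    by_contra! hc
    refine hyy (Finset.sum_lt_sum (fun j _ => hc j) ⟨v, Finset.mem_univ _, ?_⟩)
    rw [hν.symm, hμ.symm y v]
    exact hy
  have hyz : G.Adj y z := hν.adj (by omega)
  have hzv : z ≠ v := by
    rintro rfl
    rw [hν.symm y, hμ.symm y] at hz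
    omega
  obtain ⟨ν₁, hν₁, hw₁⟩ := hν.exists_sub_edge (v := y) (y := z) (by omega)
  by_cases hzz : utility μ z < utility ν z
  · obtain ⟨μ', hμ', hu'⟩ := hμ₁.exists_add_edge hyz
    obtain ⟨ν', hν', hw'⟩ := hν₁.exists_add_edge hvy
    refine ⟨z, .inr ⟨hzz, ⟨μ', hμ', fun i => ?_⟩, ν', hν', fun i => ?_⟩⟩
    · have := hu' i; have := hu₁ i; omega
    · have := hw' i; have := hw₁ i; omega
  have hz1 := hu₁ z
  have hz2 := hw₁ z
  rw [unit_self, unit_of_ne hyz.ne'] at hz2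
  rw [unit_of_ne hzv, unit_of_ne hyz.ne'] at hz1
  -- The walk continues from `z`, with the two traversed units removed. Their contributions at `y`
  -- cancel, and `μ` has a surplus at `z` again because only `ν` lost a unit there.
  obtain ⟨x, ⟨ν', hν', hx, hu'⟩ | ⟨hx, ⟨μ', hμ', hu'⟩, ν', hν', hw'⟩⟩ :=
    ih (∑ i, utility μ₁ i) (by have := sum_eq_of_units hu₁; omega) hμ₁ hν₁ (v := z) (by omega) rfl
  · obtain ⟨ν'', hν'', hu''⟩ := hν'.exists_add_edge hvy
    -- The walk may close up at `x = v`; the term `unit v x` then asks for a surplus of two units.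
    refine ⟨x, .inl ⟨ν'', hν'', ?_, fun i => ?_⟩⟩
    · have := hu₁ x; have := hw₁ x; omega
    · have := hu₁ i; have := hw₁ i; have := hu' i; have := hu'' i; omega
  · obtain ⟨μ'', hμ'', hu''⟩ := hμ'.exists_add_edge hyz
    obtain ⟨ν'', hν'', hw''⟩ := hν'.exists_add_edge hvy
    refine ⟨x, .inr ⟨?_, ⟨μ'', hμ'', fun i => ?_⟩, ν'', hν'', fun i => ?_⟩⟩
    · have h1 := hu₁ x; have h2 := hw₁ x
      -- The case `x = v` is contradictory: `μ` exceeded `ν` at `v` and lost a single unit there, so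
      -- no deficit can have arisen.
      by_cases hxv : x = v
      · subst hxv
        simp only [unit_self, unit_of_ne hzv.symm, unit_of_ne hvy.ne] at h1 h2
        omega
      · rw [unit_of_ne hxv] at h1
        omega
    · have := hu₁ i; have := hw₁ i; have := hu' i; have := hu'' i; omega
    · have := hu₁ i; have := hw₁ i; have := hw' i; have := hw'' i; omega

theorem IsEdgeArray.even_sum_utility (hμ : IsEdgeArray G μ) : Even (∑ i, utility μ i) := by
  induction hn : ∑ i, utility μ i using Nat.strong_induction_on generalizing μ with
  | _ n ih =>
  by_cases h : ∃ v y, 0 < μ v y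
  · obtain ⟨v, y, h⟩ := h
    obtain ⟨μ', hμ', hu⟩ := hμ.exists_sub_edge h
    have h2 := sum_eq_of_units hu
    rw [← hn, h2]
    exact (ih _ (by omega) hμ' rfl).add even_two
  · push Not at h
    have h0 : ∑ i, utility μ i = 0 := Finset.sum_eq_zero fun i _ =>
      Finset.sum_eq_zero fun j _ => Nat.le_zero.mp (h i j)
    rw [← hn, h0]
    exact Even.zero

theorem IsBMatching.isEdgeArray (hμ : IsBMatching G b μ) : IsEdgeArray G μ := ⟨hμ.symm, hμ.eq_zero⟩

theorem IsEdgeArray.isBMatching (hμ : IsEdgeArray G μ) (h : ∀ i, utility μ i ≤ b i) :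
    IsBMatching G b μ := ⟨hμ.symm, hμ.eq_zero, h⟩

theorem exists_isMaxBMatching (G : SimpleGraph V) (b : V → ℕ) : ∃ μ, IsMaxBMatching G b μ := by
  have hfin : {μ : V → V → ℕ | IsBMatching G b μ}.Finite := by
    refine Set.Finite.subset (Set.finite_Icc (0 : V → V → ℕ) (fun i _ => b i)) ?_
    intro μ hμ
    refine ⟨fun i j => Nat.zero_le _, fun i j => ?_⟩
    exact (Finset.single_le_sum (f := fun j => μ i j) (fun j _ => Nat.zero_le _)
      (Finset.mem_univ j)).trans (hμ.utility_le i)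
  have hne : {μ : V → V → ℕ | IsBMatching G b μ}.Nonempty :=
    ⟨_, (IsEdgeArray.zero (G := G)).isBMatching (b := b) fun i => by simp [utility]⟩
  obtain ⟨μ, hμ, hmax⟩ := Set.exists_max_image _ (fun μ => ∑ i, utility μ i) hfin hne
  exact ⟨μ, hμ, hmax⟩

theorem IsMaxBMatching.of_sum_le (hμ : IsMaxBMatching G b μ) (hν : IsBMatching G b ν)
    (h : ∑ i, utility μ i ≤ ∑ i, utility ν i) : IsMaxBMatching G b ν :=
  ⟨hν, fun ρ hρ => (hμ.2 ρ hρ).trans h⟩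

theorem IsMaxBMatching.utility_eq (hμ : IsMaxBMatching G b μ) {i : V}
    (hi : i ∉ underdemanded G b) : utility μ i = b i :=
  le_antisymm (hμ.1.utility_le i) (not_lt.mp fun h => hi ⟨μ, hμ, h⟩)

theorem sum_eq_of_exchange {p q : V → ℕ} {v x : V} (h : ∀ i, p i + unit v i = q i + unit x i) :
    ∑ i, p i = ∑ i, q i := by
  have := Finset.sum_congr (rfl : (Finset.univ : Finset V) = Finset.univ) fun i _ => h i
  rw [Finset.sum_add_distrib, Finset.sum_add_distrib, sum_unit, sum_unit] at this
  omega

/-- A b-matching can be moved off `v` if some maximum b-matching leaves `v` unsaturated; the unit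
lost at `v` reappears at another underdemanded vertex. -/
theorem IsBMatching.exists_shift (hμ : IsBMatching G b μ) (hν : IsMaxBMatching G b ν) {v : V}
    (hv : utility ν v < b v) : ∃ x ∈ underdemanded G b, ∃ μ', IsEdgeArray G μ' ∧
      utility μ x < b x ∧ ∀ i, utility μ' i + unit v i = utility μ i + unit x i := by
  by_cases h : utility ν v < utility μ v
  · obtain ⟨x, ⟨ν', hν', hx, hu⟩ | ⟨hx, ⟨μ', hμ', hu⟩, ν', hν', hw⟩⟩ :=
      hμ.isEdgeArray.exchange hν.1.isEdgeArray h
    -- This outcome would augment the maximum b-matching `ν`; the room at `x` comes from `utility μ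
    -- x ≤ b x`.
    · exfalso
      have hb : IsBMatching G b ν' := hν'.isBMatching fun i => by
        have h1 := hu i; have h2 := hν.1.utility_le i
        have h3 := hμ.utility_le i
        rcases unit_eq_one_or x i with ⟨rfl, h4⟩ | ⟨-, h4⟩
        · omega
        · rcases unit_eq_one_or v i with ⟨rfl, h5⟩ | ⟨-, h5⟩ <;> omega
      have := hν.2 _ hb
      have := sum_eq_of_units hu
      omega
    -- The same walk moves a unit of `ν` from `x` to `v`: the total is unchanged and `x` is now
    -- unsaturated, so `x` is underdemanded.
    · refine ⟨x, ⟨ν', hν.of_sum_le (hν'.isBMatching fun i => ?_) (sum_eq_of_exchange hw).ge, ?_⟩,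
        μ', hμ', hx.trans_le (hν.1.utility_le x), hu⟩
      · have h1 := hw i; have h2 := hν.1.utility_le i
        rcases unit_eq_one_or v i with ⟨rfl, h5⟩ | ⟨-, h5⟩ <;> omega
      · have h1 := hw x; have h2 := hν.1.utility_le x
        rcases unit_eq_one_or v x with ⟨rfl, h5⟩ | ⟨-, h5⟩
        · omega
        · rw [unit_self] at h1
          omega
  · exact ⟨v, ⟨ν, hν, hv⟩, μ, hμ.isEdgeArray, by omega, fun i => rfl⟩

/-- A b-matching that does not saturate an overdemanded vertex can be augmented by one unit at that
vertex and one unit at an underdemanded vertex. -/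
theorem IsBMatching.exists_augment (hμ : IsBMatching G b μ) {a : V} (ha : a ∈ overdemanded G b)
    (hlt : utility μ a < b a) : ∃ x ∈ underdemanded G b, ∃ μ', IsBMatching G b μ' ∧
      ∀ i, utility μ' i = utility μ i + unit a i + unit x i := by
  obtain ⟨haU, d, ⟨ν, hν, hd⟩, had⟩ := ha
  obtain ⟨x, hx, μ', hμ', hxb, hu⟩ := hμ.exists_shift hν hd
  obtain ⟨μ'', hμ'', hw⟩ := hμ'.exists_add_edge had
  have hw' : ∀ i, utility μ'' i = utility μ i + unit a i + unit x i := fun i => by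
    have := hu i; have := hw i; omega
  refine ⟨x, hx, μ'', hμ''.isBMatching fun i => ?_, hw'⟩
  have h1 := hw' i; have h2 := hμ.utility_le i
  have hxa : x ≠ a := by rintro rfl; exact haU hx
  rcases unit_eq_one_or a i with ⟨rfl, h4⟩ | ⟨-, h4⟩
  · rw [unit_of_ne hxa.symm] at h1
    omega
  · rcases unit_eq_one_or x i with ⟨rfl, h5⟩ | ⟨-, h5⟩ <;> omega

/-- A maximum b-matching matches overdemanded vertices to underdemanded ones only. -/
theorem IsMaxBMatching.eq_zero_of_overdemanded (hμ : IsMaxBMatching G b μ) {a c : V}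
    (ha : a ∈ overdemanded G b) (hc : c ∉ underdemanded G b) : μ a c = 0 := by
  by_contra hne
  have hac := hμ.1.isEdgeArray.adj (Nat.pos_of_ne_zero hne)
  obtain ⟨ρ, hρ, hu⟩ := hμ.1.isEdgeArray.exists_sub_edge (Nat.pos_of_ne_zero hne)
  have hρb : IsBMatching G b ρ := hρ.isBMatching fun i => by
    have := hu i; have := hμ.1.utility_le i; omega
  have h1 := hu a; have h2 := hμ.1.utility_le a
  rw [unit_self] at h1
  obtain ⟨x, hx, ρ', hρ', hw⟩ := hρb.exists_augment ha (by omega)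
  -- The unit removed from the pair `a, c` is regained at `a` and at an underdemanded `x ≠ c`, so a
  -- maximum b-matching misses `c`.
  have hmax := hμ.of_sum_le hρ' (by rw [sum_eq_of_units hu, sum_eq_of_units hw])
  refine hc ⟨ρ', hmax, ?_⟩
  have h3 := hw c; have h4 := hu c; have h5 := hμ.1.utility_le c
  have hxc : c ≠ x := by rintro rfl; exact hc hx
  rw [unit_self, unit_of_ne hac.ne'] at h4
  rw [unit_of_ne hxc, unit_of_ne hac.ne'] at h3
  omega

/-- Each unit missing at an overdemanded vertex allows an augmentation, which raises the total by
two and the utility of the overdemanded vertices by one. Iterating fills them all without exceeding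
the maximum. -/
theorem IsMaxBMatching.sum_add_le (hμ : IsMaxBMatching G b μ) (hν : IsBMatching G b ν) :
    ∑ i, utility ν i + 2 * ∑ i with i ∈ overdemanded G b, b i ≤
      ∑ i, utility μ i + 2 * ∑ i with i ∈ overdemanded G b, utility ν i := by
  induction hn : ∑ i, utility μ i - ∑ i, utility ν i using Nat.strong_induction_on
    generalizing ν with
  | _ n ih =>
  by_cases h : ∃ a ∈ overdemanded G b, utility ν a < b a
  · obtain ⟨a, ha, hlt⟩ := h
    obtain ⟨x, hx, ν', hν', hu⟩ := hν.exists_augment ha hlt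
    have h1 := sum_eq_of_units hu
    have h2 := hμ.2 _ hν'
    have h3 : ∑ i with i ∈ overdemanded G b, utility ν' i
        = ∑ i with i ∈ overdemanded G b, utility ν i + 1 := by
      rw [Finset.sum_congr rfl fun i _ => hu i, Finset.sum_add_distrib, Finset.sum_add_distrib]
      have hx' : x ∉ overdemanded G b := fun h => h.1 hx
      have e1 : ∑ i with i ∈ overdemanded G b, unit a i = 1 := by
        rw [sum_unit_filter, if_pos ha]
      have e2 : ∑ i with i ∈ overdemanded G b, unit x i = 0 := by
        rw [sum_unit_filter, if_neg hx']
      omega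
    have h4 := ih _ (by omega) hν' rfl
    omega
  · push Not at h
    have h2 := hμ.2 _ hν
    have : ∑ i with i ∈ overdemanded G b, b i ≤ ∑ i with i ∈ overdemanded G b, utility ν i :=
      Finset.sum_le_sum fun i hi => h i (Finset.mem_filter.mp hi).2
    omega

/-- The bounds that remain when the overdemanded vertices are deleted. -/
noncomputable def residualBound (G : SimpleGraph V) (b : V → ℕ) (i : V) : ℕ :=
  if i ∈ overdemanded G b then 0 else b i

/-- Deleting the overdemanded vertices costs `μ` at most twice their bounds, while by `sum_add_le` a
b-matching that avoids them falls short of the maximum by at least that much. -/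
theorem IsMaxBMatching.restrict_compl_overdemanded (hμ : IsMaxBMatching G b μ) :
    IsMaxBMatching G (residualBound G b) (restrict (overdemanded G b)ᶜ μ) := by
  have hbm : IsBMatching G (residualBound G b) (restrict (overdemanded G b)ᶜ μ) := by
    refine (hμ.1.isEdgeArray.isEdgeArray_restrict _).isBMatching fun i => ?_
    unfold residualBound
    split_ifs with hi
    · exact (utility_restrict_of_notMem (by simpa using hi)).le
    · exact (utility_restrict_le _ _ _).trans (hμ.1.utility_le i)
  refine ⟨hbm, fun ρ hρ => ?_⟩
  have hρ' : IsBMatching G b ρ := hρ.isEdgeArray.isBMatching fun i =>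
    (hρ.utility_le i).trans (by unfold residualBound; split_ifs <;> simp)
  have h1 := hμ.sum_add_le hρ'
  have h2 : ∑ i with i ∈ overdemanded G b, utility ρ i = 0 :=
    Finset.sum_eq_zero fun i hi => by
      have := hρ.utility_le i
      rw [residualBound, if_pos (Finset.mem_filter.mp hi).2] at this
      omega
  have h3 : ∑ i, utility μ i ≤ ∑ i, utility (restrict (overdemanded G b)ᶜ μ) i
      + 2 * ∑ i with i ∈ overdemanded G b, b i := by
    have e1 : ∀ i j, μ i j ≤ restrict (overdemanded G b)ᶜ μ i j
        + (if i ∈ overdemanded G b then μ i j else 0)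
        + (if j ∈ overdemanded G b then μ i j else 0) := by
      intro i j
      unfold restrict
      by_cases hi : i ∈ overdemanded G b <;> by_cases hj : j ∈ overdemanded G b <;> simp [hi, hj]
    have e2 : ∑ i, utility μ i ≤ ∑ i, utility (restrict (overdemanded G b)ᶜ μ) i
        + ∑ i, ∑ j, (if i ∈ overdemanded G b then μ i j else 0)
        + ∑ i, ∑ j, (if j ∈ overdemanded G b then μ i j else 0) := by
      unfold utility
      simp only [← Finset.sum_add_distrib]
      exact Finset.sum_le_sum fun i _ => Finset.sum_le_sum fun j _ => e1 i j
    have e3 : ∑ i, ∑ j, (if i ∈ overdemanded G b then μ i j else 0)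
        ≤ ∑ i with i ∈ overdemanded G b, b i := by
      rw [Finset.sum_filter]
      refine Finset.sum_le_sum fun i _ => ?_
      split_ifs
      · exact hμ.1.utility_le i
      · simp
    have e4 : ∑ i, ∑ j, (if j ∈ overdemanded G b then μ i j else 0)
        = ∑ i, ∑ j, (if i ∈ overdemanded G b then μ i j else 0) := by
      rw [Finset.sum_comm]
      simp only [hμ.1.symm]
    omega
  omega

/-- Gallai's lemma: units of vertices that are linked by a walk through underdemanded vertices are
not left over together by a maximum b-matching. -/
theorem IsMaxBMatching.not_two_missed {i j : V}
    (hij : Relation.TransGen (fun i j => G.Adj i j ∧ i ∈ underdemanded G b) i j)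
    (hμ : IsMaxBMatching G b μ) : ¬ ∀ k, utility μ k + unit i k + unit j k ≤ b k := by
  induction hij generalizing μ with
  | single h =>
    intro hle
    obtain ⟨μ', hμ', hu⟩ := hμ.1.isEdgeArray.exists_add_edge h.1
    have h1 := hμ.2 μ' (hμ'.isBMatching fun k => by rw [hu]; exact hle k)
    have h2 := sum_eq_of_units hu
    omega
  | @tail j k _ hjk ih =>
    intro hle
    have hjk' : ∀ {ρ : V → V → ℕ}, IsMaxBMatching G b ρ →
        ¬ ∀ l, utility ρ l + unit j l + unit k l ≤ b l := by
      intro ρ hρ hle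
      obtain ⟨μ', hμ', hu⟩ := hρ.1.isEdgeArray.exists_add_edge hjk.1
      have h1 := hρ.2 μ' (hμ'.isBMatching fun k => by rw [hu]; exact hle k)
      have h2 := sum_eq_of_units hu
      omega
    by_cases hji : j = i
    · subst hji
      exact hjk' hμ hle
    have hkj : k ≠ j := hjk.1.ne'
    obtain ⟨ν, hν, hlt⟩ := hjk.2
    -- Free a unit at the intermediate vertex `j`. If it lands on `i`, then `j` and `k` are missed
    -- together, against the edge between them; otherwise `i` and `j` are, against the induction
    -- hypothesis.
    obtain ⟨x, -, μ', hμ', hx, hu⟩ := hμ.1.exists_shift hν hlt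
    have hb : ∀ l, utility μ' l ≤ b l := fun l => by
      have h1 := hu l; have h2 := hμ.1.utility_le l
      rcases unit_eq_one_or x l with ⟨rfl, h4⟩ | ⟨-, h4⟩ <;> omega
    have hmax := hμ.of_sum_le (hμ'.isBMatching hb) (sum_eq_of_exchange hu).ge
    by_cases hxi : x = i
    · refine hjk' hmax fun l => ?_
      have h1 := hu l; have h2 := hle l
      subst hxi
      omega
    · refine ih hmax fun l => ?_
      have h1 := hu l; have h2 := hle l
      rcases unit_eq_one_or x l with ⟨rfl, h4⟩ | ⟨-, h4⟩
      · rcases unit_eq_one_or i l with ⟨rfl, h5⟩ | ⟨-, h5⟩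
        · exact absurd rfl hxi
        · omega
      · omega

end BMatching

end GallaiEdmonds

/-! ### Components of the underdemanded agents: factor-criticality and parity -/

section Components

open scoped Classical

namespace BMatching

variable {V : Type*} [Fintype V] {G : SimpleGraph V} {b : V → ℕ} {μ : V → V → ℕ}

/-- The vertices of a component of the subgraph induced on the underdemanded agents. -/
def componentSet (C : UComponent G b) : Set V :=
  {i | ∃ h : i ∈ underdemanded G b,
    (G.induce (underdemanded G b)).connectedComponentMk ⟨i, h⟩ = C}

theorem componentSet_subset (C : UComponent G b) : componentSet C ⊆ underdemanded G b :=
  fun _ h => h.1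

theorem componentSet_nonempty (C : UComponent G b) : (componentSet C).Nonempty := by
  induction C using SimpleGraph.ConnectedComponent.ind with
  | h v => exact ⟨v.1, v.2, rfl⟩

theorem mem_componentSet_of_adj {C : UComponent G b} {i j : V} (hi : i ∈ componentSet C)
    (hj : j ∈ underdemanded G b) (hij : G.Adj i j) : j ∈ componentSet C := by
  obtain ⟨h, rfl⟩ := hi
  refine ⟨hj, SimpleGraph.ConnectedComponent.sound (SimpleGraph.Adj.reachable ?_)⟩
  exact hij.symm

theorem componentDemand_eq (C : UComponent G b) :
    componentDemand C = ∑ i with i ∈ componentSet C, b i := by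
  unfold componentDemand
  refine Finset.sum_bij (fun i _ => i.1) (fun i hi => ?_) (fun i _ j _ h => Subtype.ext h)
    (fun i hi => ?_) (fun _ _ => rfl)
  · exact Finset.mem_filter.mpr ⟨Finset.mem_univ _, i.2, (Finset.mem_filter.mp hi).2⟩
  · obtain ⟨h, hC⟩ := (Finset.mem_filter.mp hi).2
    exact ⟨⟨i, h⟩, Finset.mem_filter.mpr ⟨Finset.mem_univ _, hC⟩, rfl⟩

/-- Nontriviality matters when `i = j`: the closed walk goes to another vertex and back. It is what
forbids missing two units at the same vertex. -/
theorem transGen_of_mem_componentSet {C : UComponent G b} (hC : C.supp.Nontrivial) {i j : V}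
    (hi : i ∈ componentSet C) (hj : j ∈ componentSet C) :
    Relation.TransGen (fun i j => G.Adj i j ∧ i ∈ underdemanded G b) i j := by
  have key : ∀ {i j : V}, i ∈ componentSet C → j ∈ componentSet C → i ≠ j →
      Relation.TransGen (fun i j => G.Adj i j ∧ i ∈ underdemanded G b) i j := by
    rintro i j ⟨hi, rfl⟩ ⟨hj, hji⟩ hne
    have hr := SimpleGraph.ConnectedComponent.exact hji.symm
    rw [SimpleGraph.reachable_iff_reflTransGen] at hr
    have h2 : Relation.ReflTransGen (fun i j => G.Adj i j ∧ i ∈ underdemanded G b) i j :=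
      Relation.ReflTransGen.lift (r := (G.induce (underdemanded G b)).Adj)
        (p := fun i j => G.Adj i j ∧ i ∈ underdemanded G b)
        (fun v : underdemanded G b => v.1) (fun a _ hac => ⟨hac, a.2⟩) _ _ hr
    exact (Relation.reflTransGen_iff_eq_or_transGen.mp h2).resolve_left (Ne.symm hne)
  by_cases hij : i = j
  · subst hij
    obtain ⟨k, hk, hki⟩ := hC.exists_ne (⟨i, hi.1⟩ : underdemanded G b)
    have hk' : k.1 ∈ componentSet C := ⟨k.2, hk⟩
    have hne : k.1 ≠ i := fun h => hki (Subtype.ext h)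
    exact (key hi hk' hne.symm).trans (key hk' hi hne)
  · exact key hi hj hij

/-- This lets the walks of Gallai's lemma be used after the deletion of the overdemanded vertices.
-/
theorem underdemanded_subset_residual :
    underdemanded G b ⊆ underdemanded G (residualBound G b) := by
  rintro i ⟨μ, hμ, hi⟩
  refine ⟨_, hμ.restrict_compl_overdemanded, (utility_restrict_le _ _ _).trans_lt ?_⟩
  rwa [residualBound, if_neg fun h => h.1 ⟨μ, hμ, hi⟩]

/-- A neighbour of a component that lies outside it is overdemanded, so enlarging the component by
vertices that are not overdemanded adds no exchange. -/
theorem IsEdgeArray.utility_restrict_componentSet (hμ : IsEdgeArray G μ) {C : UComponent G b}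
    {i : V} (hi : i ∈ componentSet C) {s : Set V} (hs : componentSet C ⊆ s)
    (hs' : Disjoint s (overdemanded G b)) :
    utility (restrict (componentSet C) μ) i = utility (restrict s μ) i := by
  refine Finset.sum_congr rfl fun j _ => ?_
  unfold restrict
  by_cases hj : j ∈ componentSet C
  · rw [if_pos ⟨hi, hj⟩, if_pos ⟨hs hi, hs hj⟩]
  rw [if_neg fun h => hj h.2]
  split_ifs with h
  · refine (hμ.eq_zero i j fun hadj => ?_).symm
    by_cases hjU : j ∈ underdemanded G b
    · exact hj (mem_componentSet_of_adj hi hjU hadj)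
    · exact Set.disjoint_left.mp hs' h.2 ⟨hjU, i, hi.1, hadj.symm⟩
  · rfl

theorem underdemanded_disjoint_overdemanded :
    Disjoint (underdemanded G b) (overdemanded G b) :=
  Set.disjoint_left.mpr fun _ h h' => h'.1 h

theorem componentSet_subset_compl (C : UComponent G b) :
    componentSet C ⊆ (overdemanded G b)ᶜ :=
  fun _ h h' => h'.1 h.1

/-- Inside a component, a maximum b-matching misses at most one unit. -/
theorem IsMaxBMatching.missed_le_one (hμ : IsMaxBMatching G b μ) {C : UComponent G b}
    (hC : C.supp.Nontrivial) {i : V} (hi : i ∈ componentSet C)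
    (hlt : utility (restrict (componentSet C) μ) i < b i) :
    ∀ j ∈ componentSet C, utility (restrict (componentSet C) μ) j + unit i j = b j := by
  have hmax := hμ.restrict_compl_overdemanded
  have heq : ∀ j ∈ componentSet C, utility (restrict (componentSet C) μ) j
      = utility (restrict (overdemanded G b)ᶜ μ) j := fun j hj =>
    hμ.1.isEdgeArray.utility_restrict_componentSet hj (componentSet_subset_compl C)
      disjoint_compl_left
  have hle : ∀ j, utility (restrict (componentSet C) μ) j ≤ b j := fun j =>
    (utility_restrict_le _ _ _).trans (hμ.1.utility_le j)
  have hres : ∀ j ∈ componentSet C, residualBound G b j = b j := fun j hj => by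
    rw [residualBound, if_neg (componentSet_subset_compl C hj)]
  -- The residual problem is used because units exchanged with overdemanded vertices become missed
  -- there, so that Gallai's lemma counts them.
  have htwo : ∀ j ∈ componentSet C, ¬ ∀ k ∈ componentSet C,
      utility (restrict (componentSet C) μ) k + unit i k + unit j k ≤ b k := by
    intro j hj h
    refine hmax.not_two_missed (i := i) (j := j)
      (Relation.TransGen.mono (fun _ _ h => ⟨h.1, underdemanded_subset_residual h.2⟩) _ _
        (transGen_of_mem_componentSet hC hi hj)) fun k => ?_
    by_cases hk : k ∈ componentSet C
    · rw [← heq k hk, hres k hk]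
      exact h k hk
    · rw [unit_of_ne (by rintro rfl; exact hk hi), unit_of_ne (by rintro rfl; exact hk hj)]
      exact hmax.1.utility_le k
  intro j hj
  by_cases hji : j = i
  · subst hji
    by_contra hne
    have h1 := hle j
    rw [unit_self] at hne
    refine htwo j hj fun k _ => ?_
    rcases unit_eq_one_or j k with ⟨rfl, h4⟩ | ⟨-, h4⟩
    · omega
    · have := hle k; omega
  · by_contra hne
    have h1 := hle j
    rw [unit_of_ne hji] at hne
    refine htwo j hj fun k _ => ?_
    rcases unit_eq_one_or j k with ⟨rfl, h4⟩ | ⟨-, h4⟩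
    · rw [unit_of_ne hji]; omega
    · have := hle k
      rcases unit_eq_one_or i k with ⟨rfl, h5⟩ | ⟨-, h5⟩ <;> omega

/-- A nontrivial component is factor-critical: it has a b-matching that misses exactly one unit, at
a prescribed vertex. -/
theorem exists_near_perfect {C : UComponent G b} (hC : C.supp.Nontrivial) {i : V}
    (hi : i ∈ componentSet C) : ∃ κ, IsEdgeArray G κ ∧
      (∀ j k, ¬ (j ∈ componentSet C ∧ k ∈ componentSet C) → κ j k = 0) ∧
      ∀ j ∈ componentSet C, utility κ j + unit i j = b j := by
  obtain ⟨μ, hμ, hlt⟩ := hi.1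
  exact ⟨restrict (componentSet C) μ, hμ.1.isEdgeArray.isEdgeArray_restrict _,
    fun j k h => if_neg h,
    hμ.missed_le_one hC hi ((utility_restrict_le _ _ _).trans_lt hlt)⟩

theorem sum_utility_restrict (s : Set V) (μ : V → V → ℕ) :
    ∑ i, utility (restrict s μ) i = ∑ i with i ∈ s, utility (restrict s μ) i := by
  rw [Finset.sum_filter]
  refine Finset.sum_congr rfl fun i _ => ?_
  split_ifs with h
  · rfl
  · exact utility_restrict_of_notMem h

/-- The utilities of an array add up to an even number, and here exactly one unit is missing. -/
theorem IsEdgeArray.componentDemand_of_missed (hμ : IsEdgeArray G μ) {C : UComponent G b} {i : V}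
    (hi : i ∈ componentSet C)
    (h : ∀ j ∈ componentSet C, utility (restrict (componentSet C) μ) j + unit i j = b j) :
    ∑ j with j ∈ componentSet C, utility (restrict (componentSet C) μ) j + 1
      = componentDemand C ∧ Odd (componentDemand C) := by
  have heven := (hμ.isEdgeArray_restrict (componentSet C)).even_sum_utility
  rw [sum_utility_restrict] at heven
  have hsum : ∑ j with j ∈ componentSet C, utility (restrict (componentSet C) μ) j + 1
      = componentDemand C := by
    rw [componentDemand_eq, ← Finset.sum_congr rfl fun j hj => h j (Finset.mem_filter.mp hj).2,
      Finset.sum_add_distrib, sum_unit_filter, if_pos hi]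
  exact ⟨hsum, hsum ▸ heven.add_one⟩

/-- For nontrivial components the oddness required in `SinkNode` is thus automatic: some maximum
b-matching misses a vertex of the component. -/
theorem odd_componentDemand {C : UComponent G b} (hC : C.supp.Nontrivial) :
    Odd (componentDemand C) := by
  obtain ⟨i, hi⟩ := componentSet_nonempty C
  obtain ⟨μ, hμ, hlt⟩ := hi.1
  exact (hμ.1.isEdgeArray.componentDemand_of_missed hi
    (hμ.missed_le_one hC hi ((utility_restrict_le _ _ _).trans_lt hlt))).2

/-- At most one unit is missed inside the component, and missing none would make its odd total even.
So every maximum b-matching meets the demand of the component node exactly. -/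
theorem IsMaxBMatching.sum_utility_componentSet (hμ : IsMaxBMatching G b μ) {C : UComponent G b}
    (hC : C.supp.Nontrivial) :
    ∑ j with j ∈ componentSet C, utility (restrict (underdemanded G b) μ) j
      = componentDemand C - 1 := by
  have heq : ∑ j with j ∈ componentSet C, utility (restrict (underdemanded G b) μ) j
      = ∑ j with j ∈ componentSet C, utility (restrict (componentSet C) μ) j :=
    Finset.sum_congr rfl fun j hj =>
      (hμ.1.isEdgeArray.utility_restrict_componentSet (Finset.mem_filter.mp hj).2
        (componentSet_subset C) underdemanded_disjoint_overdemanded).symm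
  rw [heq]
  by_cases h : ∃ i ∈ componentSet C, utility (restrict (componentSet C) μ) i < b i
  · obtain ⟨i, hi, hlt⟩ := h
    have := (hμ.1.isEdgeArray.componentDemand_of_missed hi (hμ.missed_le_one hC hi hlt)).1
    omega
  · exfalso
    push Not at h
    have heven := (hμ.1.isEdgeArray.isEdgeArray_restrict (componentSet C)).even_sum_utility
    rw [sum_utility_restrict, Finset.sum_congr rfl fun i hi => le_antisymm
      ((utility_restrict_le _ _ _).trans (hμ.1.utility_le i)) (h i (Finset.mem_filter.mp hi).2),
      ← componentDemand_eq] at heven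
    exact (Nat.not_even_iff_odd.mpr (odd_componentDemand hC)) heven

end BMatching

end Components

/-! ### Fractional Hall theorem -/

section Flows

open scoped Classical

namespace BipartiteNetwork

variable {S D : Type*}

/-- One unit on the pair `i, j`. -/
noncomputable def bump (i : S) (j : D) : S → D → ℝ := fun a c => if a = i ∧ c = j then 1 else 0

theorem bump_nonneg (i : S) (j : D) (a : S) (c : D) : 0 ≤ bump i j a c := by
  unfold bump; split_ifs <;> norm_num

theorem sum_bump_right [Fintype D] (i : S) (j : D) (a : S) :
    ∑ c, bump i j a c = if a = i then 1 else 0 := by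
  by_cases h : a = i <;> simp [bump, h]

theorem sum_bump_left [Fintype S] (i : S) (j : D) (c : D) :
    ∑ a, bump i j a c = if c = j then 1 else 0 := by
  by_cases h : c = j <;> simp [bump, h]

variable [Fintype S] [Fintype D]

/-- The shipments along the relation `r` that respect the bounds `x` and `d`. -/
structure IsShipment (r : S → D → Prop) (x : S → ℝ) (d : D → ℝ) (f : S → D → ℝ) : Prop where
  nonneg : ∀ i j, 0 ≤ f i j
  eq_zero : ∀ i j, ¬ r i j → f i j = 0
  row_le : ∀ i, ∑ j, f i j ≤ x i
  col_le : ∀ j, ∑ i, f i j ≤ d j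

theorem isCompact_isShipment (r : S → D → Prop) (x : S → ℝ) (d : D → ℝ) :
    IsCompact {f | IsShipment r x d f} := by
  have hsub : {f | IsShipment r x d f} ⊆ Set.Icc (0 : S → D → ℝ) (fun i _ => x i) := by
    intro f hf
    refine ⟨fun i j => hf.nonneg i j, fun i j => ?_⟩
    exact (Finset.single_le_sum (f := fun j => f i j) (fun j _ => hf.nonneg i j)
      (Finset.mem_univ j)).trans (hf.row_le i)
  refine IsCompact.of_isClosed_subset isCompact_Icc ?_ hsub
  have : {f | IsShipment r x d f} = (⋂ i, ⋂ j, {f : S → D → ℝ | 0 ≤ f i j}) ∩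
      (⋂ i, ⋂ j, ⋂ (_ : ¬ r i j), {f : S → D → ℝ | f i j = 0}) ∩
      (⋂ i, {f : S → D → ℝ | ∑ j, f i j ≤ x i}) ∩
      (⋂ j, {f : S → D → ℝ | ∑ i, f i j ≤ d j}) := by
    ext f
    simp only [Set.mem_ofPred_eq, Set.mem_inter_iff, Set.mem_iInter]
    exact ⟨fun h => ⟨⟨⟨h.1, h.2⟩, h.3⟩, h.4⟩, fun h => ⟨h.1.1.1, h.1.1.2, h.1.2, h.2⟩⟩
  rw [this]
  refine ((IsClosed.inter ?_ ?_).inter ?_).inter ?_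
  · exact isClosed_iInter fun i => isClosed_iInter fun j => isClosed_le (by fun_prop) (by fun_prop)
  · exact isClosed_iInter fun i => isClosed_iInter fun j => isClosed_iInter fun _ =>
      isClosed_eq (by fun_prop) (by fun_prop)
  · exact isClosed_iInter fun i => isClosed_le (by fun_prop) (by fun_prop)
  · exact isClosed_iInter fun i => isClosed_le (by fun_prop) (by fun_prop)

/-- The fractional form of Hall's theorem. -/
theorem exists_shipment_of_hall (r : S → D → Prop) (x : S → ℝ) (d : D → ℝ) (hx : ∀ i, 0 ≤ x i)
    (hd : ∀ j, 0 ≤ d j)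
    (hall : ∀ Y : Finset S, ∑ i ∈ Y, x i ≤ ∑ j with ∃ i ∈ Y, r i j, d j) :
    ∃ f, IsShipment r x d f ∧ ∀ i, ∑ j, f i j = x i := by
  have hne : {f | IsShipment r x d f}.Nonempty :=
    ⟨0, fun _ _ => le_rfl, fun _ _ _ => rfl, fun i => by simpa using hx i,
      fun j => by simpa using hd j⟩
  obtain ⟨f₀, hf₀, hmax₀⟩ := (isCompact_isShipment r x d).exists_isMaxOn hne
    (f := fun f => ∑ i, ∑ j, f i j) (by fun_prop)
  -- Among the shipments of largest total, take one with the fewest filled rows, so that the set of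
  -- deficient rows cannot be enlarged by rerouting.
  obtain ⟨f, ⟨hf, hmax⟩, hmin⟩ := WellFounded.has_min
    (measure fun f : S → D → ℝ => (Finset.univ.filter fun i => ∑ j, f i j = x i).card).wf
    {f | IsShipment r x d f ∧ ∀ g, IsShipment r x d g → ∑ i, ∑ j, g i j ≤ ∑ i, ∑ j, f i j}
    ⟨f₀, hf₀, fun g hg => hmax₀ hg⟩
  refine ⟨f, hf, ?_⟩
  by_contra hcon
  push Not at hcon
  obtain ⟨i₀, hi₀⟩ := hcon
  set Y : Finset S := Finset.univ.filter fun i => ∑ j, f i j < x i with hY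
  have hi₀Y : i₀ ∈ Y := by simpa [hY] using lt_of_le_of_ne (hf.row_le i₀) hi₀
  have hsat : ∀ i ∈ Y, ∀ j, r i j → ∑ a, f a j = d j := by
    intro i hi j hij
    by_contra hlt
    replace hlt := lt_of_le_of_ne (hf.col_le j) hlt
    have hi' : ∑ j, f i j < x i := by simpa [hY] using hi
    set ε := min (x i - ∑ j, f i j) (d j - ∑ a, f a j)
    have hε : 0 < ε := lt_min (by linarith) (by linarith)
    have hg : IsShipment r x d (fun a c => f a c + ε * bump i j a c) := by
      refine ⟨fun a c => ?_, fun a c hac => ?_, fun a => ?_, fun c => ?_⟩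
      · have := hf.nonneg a c
        have := bump_nonneg i j a c
        positivity
      · have : ¬ (a = i ∧ c = j) := by rintro ⟨rfl, rfl⟩; exact hac hij
        simp [bump, this, hf.eq_zero a c hac]
      · rw [Finset.sum_add_distrib, ← Finset.mul_sum, sum_bump_right]
        split_ifs with h
        · subst h
          have := min_le_left (x a - ∑ j, f a j) (d j - ∑ a, f a j)
          linarith
        · simpa using hf.row_le a
      · rw [Finset.sum_add_distrib, ← Finset.mul_sum, sum_bump_left]
        split_ifs with h
        · subst h
          have := min_le_right (x i - ∑ j, f i j) (d c - ∑ a, f a c)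
          linarith
        · simpa using hf.col_le c
    have h1 := hmax _ hg
    have h2 : ∑ a, ∑ c, (f a c + ε * bump i j a c) = ∑ a, ∑ c, f a c + ε := by
      simp only [Finset.sum_add_distrib, ← Finset.mul_sum, sum_bump_right]
      simp
    linarith
  have hclosed : ∀ i ∈ Y, ∀ j, r i j → ∀ a, a ∉ Y → f a j = 0 := by
    intro i hi j hij a ha
    by_contra hne
    have hpos : 0 < f a j := lt_of_le_of_ne (hf.nonneg a j) (Ne.symm hne)
    have hi' : ∑ j, f i j < x i := by simpa [hY] using hi
    have ha' : ∑ j, f a j = x a :=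
      le_antisymm (hf.row_le a) (not_lt.mp fun h => ha (by simpa [hY] using h))
    have hai : a ≠ i := by rintro rfl; exact ha hi
    -- Half of the deficit keeps row `i` deficient after it takes over `ε` from row `a`; row `a`
    -- becomes deficient, so the number of filled rows drops.
    set ε := min ((x i - ∑ j, f i j) / 2) (f a j)
    have hε : 0 < ε := lt_min (by linarith) hpos
    have hε₁ : ε ≤ (x i - ∑ j, f i j) / 2 := min_le_left _ _
    have hε₂ : ε ≤ f a j := min_le_right _ _
    have hrow : ∀ a', ∑ c, (f a' c + ε * bump i j a' c - ε * bump a j a' c)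
        = ∑ c, f a' c + ε * (if a' = i then 1 else 0) - ε * (if a' = a then 1 else 0) := by
      intro a'
      rw [Finset.sum_sub_distrib, Finset.sum_add_distrib, ← Finset.mul_sum, ← Finset.mul_sum,
        sum_bump_right, sum_bump_right]
    have hg : IsShipment r x d
        (fun a' c => f a' c + ε * bump i j a' c - ε * bump a j a' c) := by
      refine ⟨fun a' c => ?_, fun a' c hac => ?_, fun a' => ?_, fun c => ?_⟩
      · have h1 := hf.nonneg a' c
        have h2 := mul_nonneg hε.le (bump_nonneg i j a' c)
        by_cases h : a' = a ∧ c = j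
        · obtain ⟨rfl, rfl⟩ := h
          have : bump a' c a' c = 1 := by simp [bump]
          rw [this]
          linarith
        · have : bump a j a' c = 0 := by simp only [bump, if_neg h]
          rw [this]
          linarith
      · have h1 : ¬ (a' = i ∧ c = j) := by rintro ⟨rfl, rfl⟩; exact hac hij
        have h2 : ¬ (a' = a ∧ c = j) := by
          rintro ⟨rfl, rfl⟩; exact hne (hf.eq_zero _ _ hac)
        simp [bump, h1, h2, hf.eq_zero a' c hac]
      · rw [hrow]
        have := hf.row_le a'
        by_cases h1 : a' = i
        · subst h1
          rw [if_pos rfl, if_neg hai.symm]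
          linarith
        · rw [if_neg h1]
          split_ifs <;> linarith
      · rw [Finset.sum_sub_distrib, Finset.sum_add_distrib, ← Finset.mul_sum, ← Finset.mul_sum,
          sum_bump_left, sum_bump_left]
        have := hf.col_le c
        linarith
    refine hmin _ ⟨hg, fun g hg' => (hmax g hg').trans_eq ?_⟩ ?_
    · simp only [hrow]
      simp [Finset.sum_sub_distrib, Finset.sum_add_distrib]
    · refine Finset.card_lt_card (Finset.ssubset_iff_subset_ne.mpr ⟨fun a' h => ?_, fun h => ?_⟩)
      · rw [Finset.mem_filter, hrow] at h
        replace h := h.2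
        refine Finset.mem_filter.mpr ⟨Finset.mem_univ _, ?_⟩
        have := hf.row_le a'
        by_cases h1 : a' = i
        · subst h1
          rw [if_pos rfl, if_neg hai.symm] at h
          linarith
        · rw [if_neg h1] at h
          split_ifs at h <;> linarith
      · have h1 : a ∈ Finset.univ.filter fun i => ∑ j, f i j = x i := by simpa using ha'
        rw [← h, Finset.mem_filter, hrow, if_neg hai, if_pos rfl] at h1
        linarith [h1.2]
  -- The columns linked to `Y` are full and fed by `Y` alone, so the deficient rows violate Hall's
  -- condition.
  have h1 : ∑ i ∈ Y, ∑ j, f i j < ∑ i ∈ Y, x i :=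
    Finset.sum_lt_sum (fun i _ => hf.row_le i) ⟨i₀, hi₀Y, (Finset.mem_filter.mp hi₀Y).2⟩
  have h2 : ∑ j with ∃ i ∈ Y, r i j, d j ≤ ∑ i ∈ Y, ∑ j, f i j := by
    rw [Finset.sum_comm]
    refine le_trans (Finset.sum_le_sum (g := fun j => ∑ i ∈ Y, f i j) fun j hj => ?_)
      (Finset.sum_le_sum_of_subset_of_nonneg (Finset.subset_univ _)
        fun j _ _ => Finset.sum_nonneg fun i _ => hf.nonneg i j)
    obtain ⟨i, hi, hij⟩ := (Finset.mem_filter.mp hj).2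
    rw [← hsat i hi j hij]
    refine (Finset.sum_subset (Finset.subset_univ Y) fun a _ ha => ?_).ge
    exact hclosed i hi j hij a ha
  linarith [hall Y]

end BipartiteNetwork

end Flows

/-! ### The egalitarian allocation: existence, uniqueness, and its maximum flow -/

section Egalitarian

open scoped Classical

namespace BipartiteNetwork

variable {S D : Type*} (N : BipartiteNetwork S D) {R : Finset S} {T : Finset D} {t : ℝ}
  {X Y : Finset S}

theorem mem_neighbors {j : D} : j ∈ N.neighbors T X ↔ j ∈ T ∧ ∃ i ∈ X, N.link i j := by
  simp [neighbors]

theorem demand_neighbors_nonneg : 0 ≤ ∑ j ∈ N.neighbors T X, (N.demand j : ℝ) :=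
  Finset.sum_nonneg fun _ _ => Nat.cast_nonneg _

/-- The cut-down supply is continuous in the level and vanishes at level `0`, so the intermediate
value theorem gives an earlier equality. -/
theorem exists_isBottleneck_lt (ht : 0 ≤ t) (hX : X ⊆ R)
    (h : ∑ j ∈ N.neighbors T X, (N.demand j : ℝ) < ∑ i ∈ X, min t (N.supply i : ℝ)) :
    ∃ t', 0 ≤ t' ∧ t' < t ∧ N.IsBottleneck R T t' X := by
  have hcont : Continuous fun t : ℝ => ∑ i ∈ X, min t (N.supply i : ℝ) := by fun_prop
  have h0 : ∑ i ∈ X, min (0 : ℝ) (N.supply i : ℝ) = 0 :=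
    Finset.sum_eq_zero fun i _ => min_eq_left (Nat.cast_nonneg _)
  obtain ⟨t', ht', heq⟩ := intermediate_value_Icc ht hcont.continuousOn
    ⟨h0.trans_le (N.demand_neighbors_nonneg (T := T) (X := X)), h.le⟩
  refine ⟨t', ht'.1, lt_of_le_of_ne ht'.2 ?_, ?_, hX, heq⟩
  · rintro rfl
    exact h.ne heq.symm
  · rw [Finset.nonempty_iff_ne_empty]
    rintro rfl
    rw [Finset.sum_empty] at h
    exact (N.demand_neighbors_nonneg).not_gt h

variable {N} in
-- This is Hall's condition at the first bottleneck level: a violation would have been preceded by a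
-- bottleneck.
theorem IsFirstBottleneck.sum_le (h : N.IsFirstBottleneck R T t X) (hY : Y ⊆ R) :
    ∑ i ∈ Y, min t (N.supply i : ℝ) ≤ ∑ j ∈ N.neighbors T Y, (N.demand j : ℝ) := by
  by_contra! hlt
  obtain ⟨t', h0, h1, hb⟩ := N.exists_isBottleneck_lt h.level_nonneg hY hlt
  exact h.first t' Y h0 h1 hb

theorem neighbors_union : N.neighbors T (X ∪ Y) = N.neighbors T X ∪ N.neighbors T Y := by
  ext j
  simp only [mem_neighbors, Finset.mem_union, or_and_right, exists_or, and_or_left]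

theorem neighbors_inter_subset :
    N.neighbors T (X ∩ Y) ⊆ N.neighbors T X ∩ N.neighbors T Y := by
  intro j hj
  obtain ⟨hT, i, hi, hij⟩ := N.mem_neighbors.mp hj
  rw [Finset.mem_inter] at hi
  exact Finset.mem_inter.mpr ⟨N.mem_neighbors.mpr ⟨hT, i, hi.1, hij⟩,
    N.mem_neighbors.mpr ⟨hT, i, hi.2, hij⟩⟩

variable {N} in
/-- Bottlenecks at the first level are closed under union, by submodularity. -/
theorem IsBottleneck.union (hX : N.IsBottleneck R T t X) (hY : N.IsBottleneck R T t Y)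
    (hle : ∀ Z ⊆ R, ∑ i ∈ Z, min t (N.supply i : ℝ) ≤ ∑ j ∈ N.neighbors T Z, (N.demand j : ℝ)) :
    N.IsBottleneck R T t (X ∪ Y) := by
  refine ⟨hX.1.mono Finset.subset_union_left, Finset.union_subset hX.2.1 hY.2.1, ?_⟩
  refine le_antisymm (hle _ (Finset.union_subset hX.2.1 hY.2.1)) ?_
  have h1 := Finset.sum_union_inter (s₁ := X) (s₂ := Y) (f := fun i => min t (N.supply i : ℝ))
  have h2 := Finset.sum_union_inter (s₁ := N.neighbors T X) (s₂ := N.neighbors T Y)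
    (f := fun j => (N.demand j : ℝ))
  have h3 := hle (X ∩ Y) (Finset.inter_subset_left.trans hX.2.1)
  have h4 := Finset.sum_le_sum_of_subset_of_nonneg (N.neighbors_inter_subset (T := T) (X := X)
    (Y := Y)) (f := fun j => (N.demand j : ℝ)) fun _ _ _ => Nat.cast_nonneg _
  rw [N.neighbors_union]
  have h5 := hX.2.2
  have h6 := hY.2.2
  linarith

/-- The bottleneck levels form a finite union of closed sets bounded below, so the infimum is
attained. A bottleneck of largest cardinality there contains all others, by closure under union. -/
theorem exists_isFirstBottleneck {N : BipartiteNetwork S D}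
    (h : ∃ t X, 0 ≤ t ∧ N.IsBottleneck R T t X) :
    ∃ t X, N.IsFirstBottleneck R T t X := by
  set A : Set ℝ := ⋃ X ∈ R.powerset, {t | 0 ≤ t ∧ N.IsBottleneck R T t X}
  have hmem : ∀ t, t ∈ A ↔ ∃ X, 0 ≤ t ∧ N.IsBottleneck R T t X := by
    intro t
    simp only [A, Set.mem_iUnion, Set.mem_ofPred_eq, Finset.mem_powerset, exists_prop]
    exact exists_congr fun X => ⟨fun h => h.2, fun h => ⟨h.2.2.1, h⟩⟩
  have hclosed : IsClosed A := by
    refine Set.Finite.isClosed_biUnion R.powerset.finite_toSet fun X _ => ?_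
    by_cases hX : X.Nonempty ∧ X ⊆ R
    · have : {t | 0 ≤ t ∧ N.IsBottleneck R T t X} = Set.Ici 0 ∩
          {t | ∑ i ∈ X, min t (N.supply i : ℝ) = ∑ j ∈ N.neighbors T X, (N.demand j : ℝ)} := by
        ext t
        exact and_congr_right fun _ => ⟨fun h => h.2.2, fun h => ⟨hX.1, hX.2, h⟩⟩
      rw [this]
      exact isClosed_Ici.inter (isClosed_eq (by fun_prop) (by fun_prop))
    · have : {t | 0 ≤ t ∧ N.IsBottleneck R T t X} = ∅ := by
        ext t
        simp only [Set.mem_ofPred_eq, Set.mem_empty_iff_false, iff_false]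
        exact fun h => hX ⟨h.2.1, h.2.2.1⟩
      rw [this]
      exact isClosed_empty
  have hbdd : BddBelow A := ⟨0, fun t ht => ((hmem t).mp ht).choose_spec.1⟩
  have hne : A.Nonempty := by
    obtain ⟨t, X, h⟩ := h
    exact ⟨t, (hmem t).mpr ⟨X, h⟩⟩
  have ht := hclosed.csInf_mem hne hbdd
  set t := sInf A
  obtain ⟨X₀, ht0, hX₀⟩ := (hmem t).mp ht
  have hfirst : ∀ t' Y, 0 ≤ t' → t' < t → ¬ N.IsBottleneck R T t' Y := fun t' Y h0 hlt hb =>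
    (csInf_le hbdd ((hmem t').mpr ⟨Y, h0, hb⟩)).not_gt hlt
  have hle : ∀ Z ⊆ R, ∑ i ∈ Z, min t (N.supply i : ℝ) ≤
      ∑ j ∈ N.neighbors T Z, (N.demand j : ℝ) := by
    intro Z hZ
    by_contra! hlt
    obtain ⟨t', h0, h1, hb⟩ := N.exists_isBottleneck_lt ht0 hZ hlt
    exact hfirst t' Z h0 h1 hb
  obtain ⟨X, hX, hmax⟩ := Finset.exists_max_image (R.powerset.filter (N.IsBottleneck R T t))
    Finset.card ⟨X₀, Finset.mem_filter.mpr ⟨Finset.mem_powerset.mpr hX₀.2.1, hX₀⟩⟩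
  have hXb := (Finset.mem_filter.mp hX).2
  refine ⟨t, X, ht0, hXb, hfirst, fun Y hY => ?_⟩
  have hU := hXb.union hY hle
  have hcard := hmax _ (Finset.mem_filter.mpr ⟨Finset.mem_powerset.mpr hU.2.1, hU⟩)
  have heq := Finset.eq_of_subset_of_card_le (Finset.subset_union_left (s₂ := Y)) hcard
  rw [heq]
  exact Finset.subset_union_right

variable {N}

theorem IsFirstBottleneck.unique {t' : ℝ} (h : N.IsFirstBottleneck R T t X)
    (h' : N.IsFirstBottleneck R T t' Y) : t = t' ∧ X = Y := by
  have ht : t = t' := by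
    rcases lt_trichotomy t t' with hlt | heq | hlt
    · exact absurd h.isBottleneck (h'.first _ _ h.level_nonneg hlt)
    · exact heq
    · exact absurd h'.isBottleneck (h.first _ _ h'.level_nonneg hlt)
  subst ht
  exact ⟨rfl, (h'.largest _ h.isBottleneck).antisymm (h.largest _ h'.isBottleneck)⟩

theorem EgalitarianOn.congr {x y : S → ℝ} (h : N.EgalitarianOn x R T) (hxy : ∀ i ∈ R, x i = y i) :
    N.EgalitarianOn y R T := by
  induction h with
  | done R T none_left value =>
    exact .done R T none_left fun i hi => (hxy i hi).symm.trans (value i hi)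
  | step R T t X bottleneck value _ ih =>
    exact .step R T t X bottleneck
      (fun i hi => (hxy i (bottleneck.isBottleneck.2.1 hi)).symm.trans (value i hi))
      (ih fun i hi => hxy i (Finset.mem_sdiff.mp hi).1)

theorem EgalitarianOn.unique {x y : S → ℝ} (hx : N.EgalitarianOn x R T)
    (hy : N.EgalitarianOn y R T) : ∀ i ∈ R, x i = y i := by
  induction hx with
  | done R T none_left value =>
    cases hy with
    | done _ _ _ value' => exact fun i hi => (value i hi).trans (value' i hi).symm
    | step _ _ t X bottleneck =>
      exact absurd bottleneck.isBottleneck (none_left t X bottleneck.level_nonneg)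
  | step R T t X bottleneck value _ ih =>
    cases hy with
    | done _ _ none_left =>
      exact absurd bottleneck.isBottleneck (none_left t X bottleneck.level_nonneg)
    | step _ _ t' X' bottleneck' value' rest' =>
      obtain ⟨rfl, rfl⟩ := bottleneck.unique bottleneck'
      intro i hi
      by_cases hiX : i ∈ X
      · rw [value i hiX, value' i hiX]
      · exact ih rest' i (Finset.mem_sdiff.mpr ⟨hi, hiX⟩)

variable (N) in
theorem exists_egalitarianOn (R : Finset S) (T : Finset D) : ∃ x, N.EgalitarianOn x R T := by
  induction hn : R.card using Nat.strong_induction_on generalizing R T with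
  | _ n ih =>
  by_cases h : ∃ t X, 0 ≤ t ∧ N.IsBottleneck R T t X
  · obtain ⟨t, X, hX⟩ := exists_isFirstBottleneck h
    have hlt : (R \ X).card < R.card := Finset.card_lt_card <|
      Finset.sdiff_ssubset hX.isBottleneck.2.1 hX.isBottleneck.1
    obtain ⟨x, hx⟩ := ih _ (hn ▸ hlt) (R \ X) (T \ N.neighbors T X) rfl
    refine ⟨fun i => if i ∈ X then min t (N.supply i : ℝ) else x i, .step R T t X hX
      (fun i hi => if_pos hi) (hx.congr fun i hi => ?_)⟩
    rw [if_neg (Finset.mem_sdiff.mp hi).2]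
  · push Not at h
    exact ⟨fun i => N.supply i, .done R T h fun _ _ => rfl⟩

theorem EgalitarianOn.le_supply {x : S → ℝ} (h : N.EgalitarianOn x R T) :
    ∀ i ∈ R, x i ≤ N.supply i := by
  induction h with
  | done R T none_left value => exact fun i hi => (value i hi).le
  | step R T t X bottleneck value _ ih =>
    intro i hi
    by_cases hiX : i ∈ X
    · exact (value i hiX).trans_le (min_le_right _ _)
    · exact ih i (Finset.mem_sdiff.mpr ⟨hi, hiX⟩)

variable [Fintype S]

variable (N) in
theorem existsUnique_isEgalitarianAllocation [Fintype D] :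
    ∃! x : S → ℝ, N.IsEgalitarianAllocation x := by
  obtain ⟨x, hx⟩ := N.exists_egalitarianOn Finset.univ Finset.univ
  exact ⟨x, hx, fun y hy => funext fun i => hy.unique hx i (Finset.mem_univ i)⟩

variable [Fintype D]

theorem exists_shipment_on (N : BipartiteNetwork S D) (R : Finset S) (T : Finset D) (x : S → ℝ)
    (hx : ∀ i ∈ R, 0 ≤ x i)
    (hall : ∀ Y ⊆ R, ∑ i ∈ Y, x i ≤ ∑ j ∈ N.neighbors T Y, (N.demand j : ℝ)) :
    ∃ f : S → D → ℝ, (∀ i j, 0 ≤ f i j) ∧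
      (∀ i j, ¬ (i ∈ R ∧ j ∈ T ∧ N.link i j) → f i j = 0) ∧ (∀ i ∈ R, ∑ j, f i j = x i) ∧
      ∀ j, ∑ i, f i j ≤ N.demand j := by
  obtain ⟨f, hf, hrow⟩ := exists_shipment_of_hall (fun i j => i ∈ R ∧ j ∈ T ∧ N.link i j)
    (fun i => if i ∈ R then x i else 0) (fun j => (N.demand j : ℝ))
    (fun i => by split_ifs with h; exacts [hx i h, le_rfl]) (fun j => Nat.cast_nonneg _)
    (fun Y => by
      have h1 := hall (Y.filter (· ∈ R)) fun i hi => (Finset.mem_filter.mp hi).2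
      rw [Finset.sum_filter] at h1
      refine h1.trans_eq (Finset.sum_congr ?_ fun _ _ => rfl)
      ext j
      simp only [mem_neighbors, Finset.mem_filter, Finset.mem_univ, true_and]
      constructor
      · rintro ⟨hj, i, ⟨hi, hiR⟩, hij⟩
        exact ⟨i, hi, hiR, hj, hij⟩
      · rintro ⟨i, hi, hiR, hj, hij⟩
        exact ⟨hj, i, ⟨hi, hiR⟩, hij⟩)
  exact ⟨f, hf.nonneg, hf.eq_zero, fun i hi => (hrow i).trans (if_pos hi), hf.col_le⟩

/-- The egalitarian allocation is shipped by a flow of the subproblem. -/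
theorem EgalitarianOn.exists_flow {x : S → ℝ} (h : N.EgalitarianOn x R T) :
    ∃ f : S → D → ℝ, (∀ i j, 0 ≤ f i j) ∧
      (∀ i j, ¬ (i ∈ R ∧ j ∈ T ∧ N.link i j) → f i j = 0) ∧ (∀ i ∈ R, ∑ j, f i j = x i) ∧
      ∀ j, ∑ i, f i j ≤ N.demand j := by
  induction h with
  | done R T none_left value =>
    refine N.exists_shipment_on R T x (fun i hi => (value i hi).symm ▸ Nat.cast_nonneg _)
      fun Y hY => ?_
    by_contra! hlt
    -- At the level of the total supply nothing is cut down, so a failure of Hall's condition would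
    -- yield a bottleneck below it.
    have hmin : ∀ i ∈ Y, x i = min (∑ i, (N.supply i : ℝ)) (N.supply i : ℝ) := fun i hi => by
      rw [value i (hY hi), min_eq_right]
      exact Finset.single_le_sum (f := fun i => (N.supply i : ℝ)) (fun _ _ => Nat.cast_nonneg _)
        (Finset.mem_univ i)
    rw [Finset.sum_congr rfl hmin] at hlt
    obtain ⟨t', h0, -, hb⟩ := N.exists_isBottleneck_lt
      (Finset.sum_nonneg fun _ _ => Nat.cast_nonneg _) hY hlt
    exact none_left t' Y h0 hb
  | step R T t X bottleneck value _ ih =>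
    obtain ⟨f, hf0, hfz, hfr, hfc⟩ := ih
    have hXR := bottleneck.isBottleneck.2.1
    obtain ⟨g, hg0, hgz, hgr, hgc⟩ := N.exists_shipment_on X T x
      (fun i hi => (value i hi).symm ▸ le_min bottleneck.level_nonneg (Nat.cast_nonneg _))
      (fun Y hY => by
        rw [Finset.sum_congr rfl fun i hi => value i (hY hi)]
        exact bottleneck.sum_le (hY.trans hXR))
    -- The two flows use disjoint rows and disjoint columns, so their sum respects the bounds.
    refine ⟨fun i j => f i j + g i j, fun i j => add_nonneg (hf0 i j) (hg0 i j),
      fun i j hij => ?_, fun i hi => ?_, fun j => ?_⟩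
    · change f i j + g i j = 0
      rw [hfz i j fun h => hij ⟨(Finset.mem_sdiff.mp h.1).1, (Finset.mem_sdiff.mp h.2.1).1, h.2.2⟩,
        hgz i j fun h => hij ⟨hXR h.1, h.2⟩, add_zero]
    · rw [Finset.sum_add_distrib]
      by_cases hiX : i ∈ X
      · rw [hgr i hiX, Finset.sum_eq_zero fun j _ =>
          hfz i j fun h => (Finset.mem_sdiff.mp h.1).2 hiX, zero_add]
      · rw [hfr i (Finset.mem_sdiff.mpr ⟨hi, hiX⟩), Finset.sum_eq_zero fun j _ =>
          hgz i j fun h => hiX h.1, add_zero]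
    · rw [Finset.sum_add_distrib]
      by_cases hj : j ∈ N.neighbors T X
      · rw [Finset.sum_eq_zero fun i _ => hfz i j fun h => (Finset.mem_sdiff.mp h.2.1).2 hj,
          zero_add]
        exact hgc j
      · have : ∑ i, g i j = 0 := Finset.sum_eq_zero fun i _ =>
          hgz i j fun h => hj (N.mem_neighbors.mpr ⟨h.2.1, i, h.1, h.2.2⟩)
        rw [this, add_zero]
        exact hfc j

/-- No flow ships more in total than the egalitarian allocation. -/
theorem EgalitarianOn.sum_le {x : S → ℝ} (h : N.EgalitarianOn x R T) {g : S → D → ℝ}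
    (hg : N.IsFlow g) : ∑ i ∈ R, ∑ j ∈ T, g i j ≤ ∑ i ∈ R, x i := by
  induction h with
  | done R T none_left value =>
    refine Finset.sum_le_sum fun i hi => ?_
    rw [value i hi]
    exact (Finset.sum_le_sum_of_subset_of_nonneg (Finset.subset_univ T)
      fun j _ _ => hg.nonneg i j).trans (hg.outflow_le i)
  | step R T t X bottleneck value _ ih =>
    have hXR := bottleneck.isBottleneck.2.1
    have hNT : N.neighbors T X ⊆ T := Finset.filter_subset _ _
    -- Members of `X` ship only into their neighbours, whose total demand is exactly what the
    -- allocation gives to `X`.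
    have hsplit : ∑ i ∈ R, ∑ j ∈ T, g i j ≤
        ∑ i ∈ R \ X, ∑ j ∈ T \ N.neighbors T X, g i j + ∑ j ∈ N.neighbors T X, ∑ i, g i j := by
      have h1 : ∀ i ∈ R, ∑ j ∈ T, g i j ≤ (if i ∈ X then 0 else
          ∑ j ∈ T \ N.neighbors T X, g i j) + ∑ j ∈ N.neighbors T X, g i j := by
        intro i hi
        rw [← Finset.sum_sdiff hNT]
        split_ifs with hiX
        · refine add_le_add (Finset.sum_eq_zero fun j hj => hg.eq_zero i j fun hij => ?_).le le_rfl
          rw [Finset.mem_sdiff] at hj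
          exact hj.2 (N.mem_neighbors.mpr ⟨hj.1, i, hiX, hij⟩)
        · exact le_rfl
      refine (Finset.sum_le_sum h1).trans ?_
      rw [Finset.sum_add_distrib]
      refine add_le_add (le_of_eq ?_) ?_
      · rw [← Finset.sum_sdiff hXR, Finset.sum_eq_zero (s := X) fun i hi => if_pos hi, add_zero]
        exact Finset.sum_congr rfl fun i hi => if_neg (Finset.mem_sdiff.mp hi).2
      · rw [Finset.sum_comm]
        exact Finset.sum_le_sum fun j _ => Finset.sum_le_sum_of_subset_of_nonneg
          (Finset.subset_univ R) fun i _ _ => hg.nonneg i j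
    have h2 : ∑ j ∈ N.neighbors T X, ∑ i, g i j ≤ ∑ i ∈ X, x i := by
      rw [Finset.sum_congr rfl value, bottleneck.isBottleneck.2.2]
      exact Finset.sum_le_sum fun j _ => hg.inflow_le j
    rw [← Finset.sum_sdiff hXR (f := x)]
    linarith

variable (N) in
theorem exists_isEgalitarianMaxFlow : ∃ f, N.IsEgalitarianMaxFlow f := by
  obtain ⟨x, hx⟩ := N.exists_egalitarianOn Finset.univ Finset.univ
  obtain ⟨f, h0, hz, hr, hc⟩ := hx.exists_flow
  have hout : outflow f = x := funext fun i => hr i (Finset.mem_univ i)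
  refine ⟨f, ⟨⟨h0, fun i j hij => hz i j fun h => hij h.2.2, fun i => ?_, hc⟩, fun g hg => ?_⟩, ?_⟩
  · rw [hout]
    exact hx.le_supply i (Finset.mem_univ i)
  · unfold flowValue
    rw [hout]
    exact hx.sum_le hg
  · rw [hout]
    exact hx

end BipartiteNetwork

end Egalitarian

/-! ### Integral extreme flows, convex decompositions, and the linear program -/

section Integrality

open scoped Classical

namespace BipartiteNetwork

variable {S D : Type*}

/-- If every row in `A` and every column in `B` that meets the nonempty set `E` of cells does so at
least twice, then some nonzero array supported on `E` has vanishing sums on these rows and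
columns. -/
theorem exists_circulation [Fintype S] [Fintype D] (E : Finset (S × D)) (A : Finset S)
    (B : Finset D) (hE : E.Nonempty)
    (hA : ∀ i ∈ A, ∀ e ∈ E, e.1 = i → 2 ≤ (E.filter fun e => e.1 = i).card)
    (hB : ∀ j ∈ B, ∀ e ∈ E, e.2 = j → 2 ≤ (E.filter fun e => e.2 = j).card) :
    ∃ g : S → D → ℝ, g ≠ 0 ∧ (∀ i j, (i, j) ∉ E → g i j = 0) ∧ (∀ i ∈ A, ∑ j, g i j = 0) ∧
      ∀ j ∈ B, ∑ i, g i j = 0 := by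
  set A' := A.filter fun i => ∃ e ∈ E, e.1 = i
  set B' := B.filter fun j => ∃ e ∈ E, e.2 = j
  have hcA : 2 * A'.card ≤ ∑ i ∈ A', (E.filter fun e => e.1 = i).card := by
    rw [mul_comm, ← smul_eq_mul]
    refine Finset.card_nsmul_le_sum _ _ _ fun i hi => ?_
    obtain ⟨hi, e, he, rfl⟩ := Finset.mem_filter.mp hi
    exact hA _ hi e he rfl
  have hcB : 2 * B'.card ≤ ∑ j ∈ B', (E.filter fun e => e.2 = j).card := by
    rw [mul_comm, ← smul_eq_mul]
    refine Finset.card_nsmul_le_sum _ _ _ fun i hi => ?_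
    obtain ⟨hi, e, he, rfl⟩ := Finset.mem_filter.mp hi
    exact hB _ hi e he rfl
  have hsA : ∑ i ∈ A', (E.filter fun e => e.1 = i).card = (E.filter fun e => e.1 ∈ A').card := by
    rw [Finset.card_eq_sum_card_fiberwise (s := E.filter fun e => e.1 ∈ A') (f := Prod.fst)
      (t := A') (fun e he => (Finset.mem_filter.mp he).2)]
    refine Finset.sum_congr rfl fun i hi => ?_
    rw [Finset.filter_filter]
    congr 1
    refine Finset.filter_congr fun e _ => ⟨fun h => ⟨h ▸ hi, h⟩, fun h => h.2⟩
  have hsB : ∑ j ∈ B', (E.filter fun e => e.2 = j).card = (E.filter fun e => e.2 ∈ B').card := by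
    rw [Finset.card_eq_sum_card_fiberwise (s := E.filter fun e => e.2 ∈ B') (f := Prod.snd)
      (t := B') (fun e he => (Finset.mem_filter.mp he).2)]
    refine Finset.sum_congr rfl fun i hi => ?_
    rw [Finset.filter_filter]
    congr 1
    refine Finset.filter_congr fun e _ => ⟨fun h => ⟨h ▸ hi, h⟩, fun h => h.2⟩
  have hleA : (E.filter fun e => e.1 ∈ A').card ≤ E.card := Finset.card_filter_le _ _
  have hleB : (E.filter fun e => e.2 ∈ B').card ≤ E.card := Finset.card_filter_le _ _
  let L : (E → ℝ) →ₗ[ℝ] ((A' → ℝ) × (B' → ℝ)) :=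
    { toFun := fun g => (fun i => ∑ e, if e.1.1 = i.1 then g e else 0,
        fun j => ∑ e, if e.1.2 = j.1 then g e else 0)
      map_add' := fun g h => by
        ext <;> simp [← Finset.sum_add_distrib, ite_add_ite]
      map_smul' := fun c g => by
        ext <;> simp [Finset.mul_sum] }
  -- There are at most `E.card` equations, since `A'` and `B'` each have at most half that size. In
  -- the case of equality every cell counts in both families and the equations are dependent: row
  -- sums and column sums have the same total.
  have hker : ¬ Function.Injective L := by
    intro hinj
    have hdim := LinearMap.finrank_le_finrank_of_injective hinj
    rw [Module.finrank_prod, Module.finrank_fintype_fun_eq_card,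
      Module.finrank_fintype_fun_eq_card, Module.finrank_fintype_fun_eq_card, Fintype.card_coe,
      Fintype.card_coe, Fintype.card_coe] at hdim
    have hfA : E.filter (fun e => e.1 ∈ A') = E :=
      Finset.eq_of_subset_of_card_le (Finset.filter_subset _ _) (by omega)
    have hfB : E.filter (fun e => e.2 ∈ B') = E :=
      Finset.eq_of_subset_of_card_le (Finset.filter_subset _ _) (by omega)
    have hsurj : Function.Surjective L := by
      refine (LinearMap.injective_iff_surjective_of_finrank_eq_finrank ?_).mp hinj
      rw [Module.finrank_prod, Module.finrank_fintype_fun_eq_card,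
        Module.finrank_fintype_fun_eq_card, Module.finrank_fintype_fun_eq_card, Fintype.card_coe,
        Fintype.card_coe, Fintype.card_coe]
      omega
    obtain ⟨e₀, he₀⟩ := hE
    have he₀A : e₀.1 ∈ A' := Finset.filter_eq_self.mp hfA _ he₀
    obtain ⟨g, hg⟩ := hsurj (Pi.single ⟨e₀.1, he₀A⟩ 1, 0)
    have h1 : ∑ i, (L g).1 i = ∑ e, g e := by
      simp only [L, LinearMap.coe_mk, AddHom.coe_mk]
      rw [Finset.sum_comm]
      refine Finset.sum_congr rfl fun e _ => ?_
      have hm : e.1.1 ∈ A' := Finset.filter_eq_self.mp hfA _ e.2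
      rw [Finset.sum_eq_single ⟨e.1.1, hm⟩ (fun i _ hi => if_neg fun h => hi (Subtype.ext h.symm))
        (fun h => absurd (Finset.mem_univ _) h), if_pos rfl]
    have h2 : ∑ j, (L g).2 j = ∑ e, g e := by
      simp only [L, LinearMap.coe_mk, AddHom.coe_mk]
      rw [Finset.sum_comm]
      refine Finset.sum_congr rfl fun e _ => ?_
      have hm : e.1.2 ∈ B' := Finset.filter_eq_self.mp hfB _ e.2
      rw [Finset.sum_eq_single ⟨e.1.2, hm⟩ (fun i _ hi => if_neg fun h => hi (Subtype.ext h.symm))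
        (fun h => absurd (Finset.mem_univ _) h), if_pos rfl]
    rw [hg] at h1 h2
    simp only [Pi.zero_apply, Finset.sum_const_zero] at h2
    rw [← h2] at h1
    simp at h1
  obtain ⟨g, hg, hg0⟩ : ∃ g, L g = 0 ∧ g ≠ 0 := by
    rw [← LinearMap.ker_eq_bot, Submodule.eq_bot_iff] at hker
    push Not at hker
    exact hker
  have hg1 := congrArg Prod.fst hg
  have hg2 := congrArg Prod.snd hg
  let G : S → D → ℝ := fun i j => if h : (i, j) ∈ E then g ⟨(i, j), h⟩ else 0
  have hrow : ∀ i, ∑ j, G i j = ∑ e : E, if e.1.1 = i then g e else 0 := by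
    intro i
    have h1 : ∑ e : E, (if e.1.1 = i then g e else 0)
        = ∑ e ∈ E, if e.1 = i then G e.1 e.2 else 0 := by
      rw [← Finset.sum_coe_sort E]
      refine Finset.sum_congr rfl fun e _ => ?_
      simp only [G, Prod.mk.eta, e.2, dite_true, Subtype.coe_eta]
    rw [h1, Finset.sum_subset (Finset.subset_univ E) fun e _ he => by simp [G, he],
      Fintype.sum_prod_type]
    simp
  have hcol : ∀ j, ∑ i, G i j = ∑ e : E, if e.1.2 = j then g e else 0 := by
    intro j
    have h1 : ∑ e : E, (if e.1.2 = j then g e else 0)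
        = ∑ e ∈ E, if e.2 = j then G e.1 e.2 else 0 := by
      rw [← Finset.sum_coe_sort E]
      refine Finset.sum_congr rfl fun e _ => ?_
      simp only [G, Prod.mk.eta, e.2, dite_true, Subtype.coe_eta]
    rw [h1, Finset.sum_subset (Finset.subset_univ E) fun e _ he => by simp [G, he],
      Fintype.sum_prod_type]
    simp
  refine ⟨G, fun h => hg0 ?_, fun i j h => dif_neg h, fun i hi => ?_, fun j hj => ?_⟩
  · ext ⟨⟨i, j⟩, he⟩
    have := congrFun (congrFun h i) j
    simp only [G, dif_pos he] at this
    exact this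
  · by_cases hiA : i ∈ A'
    · rw [hrow]
      exact congrFun hg1 ⟨i, hiA⟩
    · refine Finset.sum_eq_zero fun j _ => dif_neg fun h => hiA ?_
      exact Finset.mem_filter.mpr ⟨hi, _, h, rfl⟩
  · by_cases hjB : j ∈ B'
    · rw [hcol]
      exact congrFun hg2 ⟨j, hjB⟩
    · refine Finset.sum_eq_zero fun i _ => dif_neg fun h => hjB ?_
      exact Finset.mem_filter.mpr ⟨hj, _, h, rfl⟩

/-- A finite sum of reals that is an integer does not have exactly one nonintegral summand. -/
theorem exists_ne_nonintegral {ι : Type*} [Fintype ι] {u : ι → ℝ} {i : ι}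
    (hsum : ∑ k, u k ∈ Set.range ((↑) : ℤ → ℝ)) (hi : u i ∉ Set.range ((↑) : ℤ → ℝ)) :
    ∃ k ≠ i, u k ∉ Set.range ((↑) : ℤ → ℝ) := by
  by_contra! h
  refine hi ?_
  have hmem : ∀ z : ℝ, z ∈ Set.range ((↑) : ℤ → ℝ) ↔ z ∈ (Int.castAddHom ℝ).range :=
    fun _ => Iff.rfl
  rw [hmem] at hsum ⊢
  rw [← Finset.add_sum_erase _ _ (Finset.mem_univ i)] at hsum
  refine (AddSubgroup.add_mem_cancel_right _ (AddSubgroup.sum_mem _ fun k hk => ?_)).mp hsum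
  exact h k (Finset.ne_of_mem_erase hk)

variable [Fintype S] [Fintype D] {N : BipartiteNetwork S D}

theorem flowValue_add (f g : S → D → ℝ) : flowValue (f + g) = flowValue f + flowValue g := by
  simp [flowValue, outflow, Finset.sum_add_distrib]

theorem flowValue_smul (c : ℝ) (f : S → D → ℝ) : flowValue (c • f) = c * flowValue f := by
  simp [flowValue, outflow, Finset.mul_sum]

/-- The direction `g` changes only entries, row sums and column sums whose constraints are slack, so
small steps of either sign stay feasible. -/
theorem IsFlow.eventually_add_smul {f g : S → D → ℝ} (hf : N.IsFlow f)
    (hcell : ∀ i j, g i j = 0 ∨ 0 < f i j)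
    (hrow : ∀ i, outflow g i = 0 ∨ outflow f i < N.supply i)
    (hcol : ∀ j, inflow g j = 0 ∨ inflow f j < N.demand j) :
    ∀ᶠ ε : ℝ in nhds 0, N.IsFlow (f + ε • g) := by
  have h1 : ∀ᶠ ε : ℝ in nhds 0, ∀ i j, 0 ≤ f i j + ε * g i j := by
    rw [Filter.eventually_all]; intro i
    rw [Filter.eventually_all]; intro j
    rcases hcell i j with h | h
    · simpa [h] using hf.nonneg i j
    · have hc : Continuous fun ε : ℝ => f i j + ε * g i j := by fun_prop
      filter_upwards [(hc.tendsto' 0 (f i j) (by simp)).eventually (lt_mem_nhds h)] with ε hε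
        using hε.le
  have h2 : ∀ᶠ ε : ℝ in nhds 0, ∀ i, outflow f i + ε * outflow g i ≤ N.supply i := by
    rw [Filter.eventually_all]; intro i
    rcases hrow i with h | h
    · simpa [h] using hf.outflow_le i
    · have hc : Continuous fun ε : ℝ => outflow f i + ε * outflow g i := by fun_prop
      filter_upwards [(hc.tendsto' 0 (outflow f i) (by simp)).eventually (gt_mem_nhds h)]
        with ε hε using hε.le
  have h3 : ∀ᶠ ε : ℝ in nhds 0, ∀ j, inflow f j + ε * inflow g j ≤ N.demand j := by
    rw [Filter.eventually_all]; intro i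
    rcases hcol i with h | h
    · simpa [h] using hf.inflow_le i
    · have hc : Continuous fun ε : ℝ => inflow f i + ε * inflow g i := by fun_prop
      filter_upwards [(hc.tendsto' 0 (inflow f i) (by simp)).eventually (gt_mem_nhds h)]
        with ε hε using hε.le
  have hz : ∀ i j, ¬ N.link i j → g i j = 0 := fun i j hij =>
    (hcell i j).resolve_right (by rw [hf.eq_zero i j hij]; exact lt_irrefl 0)
  filter_upwards [h1, h2, h3] with ε e1 e2 e3
  refine ⟨e1, fun i j hij => by simp [hf.eq_zero i j hij, hz i j hij], fun i => ?_, fun j => ?_⟩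
  · simpa [outflow, Finset.sum_add_distrib, Finset.mul_sum] using e2 i
  · simpa [inflow, Finset.sum_add_distrib, Finset.mul_sum] using e3 j

/-- The extreme points of the polytope of maximum flows are integral. -/
theorem exists_toReal_of_mem_extremePoints {f : S → D → ℝ}
    (hf : f ∈ Set.extremePoints ℝ N.maxFlowPolytope) : ∃ F : S → D → ℕ, f = toReal F := by
  have hmax : N.IsMaxFlow f := hf.1
  suffices h : ∀ i j, f i j ∈ Set.range ((↑) : ℤ → ℝ) by
    choose F hF using h
    refine ⟨fun i j => (F i j).toNat, funext fun i => funext fun j => ?_⟩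
    have h0 : 0 ≤ F i j := by
      have := hmax.1.nonneg i j
      rw [← hF i j] at this
      exact_mod_cast this
    rw [toReal, ← hF i j]
    exact_mod_cast (Int.toNat_of_nonneg h0).symm
  by_contra! hcon
  obtain ⟨i₀, j₀, h₀⟩ := hcon
  set E : Finset (S × D) := Finset.univ.filter fun e => f e.1 e.2 ∉ Set.range ((↑) : ℤ → ℝ) with hE
  have hmemE : ∀ i j, (i, j) ∈ E ↔ f i j ∉ Set.range ((↑) : ℤ → ℝ) := by simp [hE]
  -- Only integral row and column sums must be preserved: a nonintegral one is strictly below its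
  -- integral bound. A row or column with integral sum and one nonintegral entry has a second one.
  obtain ⟨g, hg0, hgE, hgr, hgc⟩ := exists_circulation E
    (Finset.univ.filter fun i => outflow f i ∈ Set.range ((↑) : ℤ → ℝ))
    (Finset.univ.filter fun j => inflow f j ∈ Set.range ((↑) : ℤ → ℝ))
    ⟨(i₀, j₀), (hmemE _ _).mpr h₀⟩
    (by
      rintro i hi ⟨i', j⟩ he rfl
      obtain ⟨k, hk, hfk⟩ := exists_ne_nonintegral (Finset.mem_filter.mp hi).2 ((hmemE _ _).mp he)
      refine Finset.one_lt_card.mpr ⟨(i', j), ?_, (i', k), ?_, ?_⟩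
      · exact Finset.mem_filter.mpr ⟨he, rfl⟩
      · exact Finset.mem_filter.mpr ⟨(hmemE _ _).mpr hfk, rfl⟩
      · simpa using hk.symm)
    (by
      rintro j hj ⟨i, j'⟩ he rfl
      obtain ⟨k, hk, hfk⟩ := exists_ne_nonintegral (Finset.mem_filter.mp hj).2 ((hmemE _ _).mp he)
      refine Finset.one_lt_card.mpr ⟨(i, j'), ?_, (k, j'), ?_, ?_⟩
      · exact Finset.mem_filter.mpr ⟨he, rfl⟩
      · exact Finset.mem_filter.mpr ⟨(hmemE _ _).mpr hfk, rfl⟩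
      · simpa using hk.symm)
  have hint : ∀ n : ℕ, (n : ℝ) ∈ Set.range ((↑) : ℤ → ℝ) := fun n => ⟨n, by simp⟩
  have hev := hmax.1.eventually_add_smul (g := g)
    (fun i j => by
      by_cases h : (i, j) ∈ E
      · right
        refine lt_of_le_of_ne (hmax.1.nonneg i j) fun h0 => (hmemE i j).mp h ?_
        rw [← h0]
        exact ⟨0, by simp⟩
      · exact .inl (hgE i j h))
    (fun i => by
      by_cases h : outflow f i ∈ Set.range ((↑) : ℤ → ℝ)
      · exact .inl (hgr i (by simpa using h))
      · right
        refine lt_of_le_of_ne (hmax.1.outflow_le i) fun h0 => h ?_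
        rw [h0]
        exact hint _)
    (fun j => by
      by_cases h : inflow f j ∈ Set.range ((↑) : ℤ → ℝ)
      · exact .inl (hgc j (by simpa using h))
      · right
        refine lt_of_le_of_ne (hmax.1.inflow_le j) fun h0 => h ?_
        rw [h0]
        exact hint _)
  have hev' : ∀ᶠ ε : ℝ in nhds 0, N.IsFlow (f + (-ε) • g) := by
    have : Filter.Tendsto (fun ε : ℝ => -ε) (nhds 0) (nhds 0) := by
      simpa using (continuous_neg (G := ℝ)).tendsto 0
    exact this.eventually hev
  obtain ⟨ε, ⟨h1, h2⟩, hε⟩ := (((hev.and hev').filter_mono nhdsWithin_le_nhds).and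
    (self_mem_nhdsWithin (s := Set.Ioi (0 : ℝ)))).exists
  -- Maximality against both perturbations forces `flowValue g = 0`, so both are maximum flows with
  -- midpoint `f`.
  have hv1 := hmax.2 _ h1
  have hv2 := hmax.2 _ h2
  rw [flowValue_add, flowValue_smul] at hv1 hv2
  have hm1 : N.IsMaxFlow (f + ε • g) := ⟨h1, fun k hk => (hmax.2 k hk).trans (by
    rw [flowValue_add, flowValue_smul]; linarith)⟩
  have hm2 : N.IsMaxFlow (f + (-ε) • g) := ⟨h2, fun k hk => (hmax.2 k hk).trans (by
    rw [flowValue_add, flowValue_smul]; linarith)⟩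
  have hseg : f ∈ openSegment ℝ (f + ε • g) (f + (-ε) • g) := by
    refine ⟨1 / 2, 1 / 2, by norm_num, by norm_num, by norm_num, ?_⟩
    ext i j
    simp only [Pi.add_apply, Pi.smul_apply, smul_eq_mul]
    ring
  have heq := hf.2 hm1 hm2 hseg
  refine hg0 (funext fun i => funext fun j => ?_)
  have := congrFun (congrFun heq i) j
  simp only [Pi.add_apply, Pi.smul_apply, smul_eq_mul, add_eq_left, mul_eq_zero] at this
  exact this.resolve_left (Set.mem_Ioi.mp hε).ne'

theorem isCompact_isFlow (N : BipartiteNetwork S D) : IsCompact {f | N.IsFlow f} := by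
  have : {f | N.IsFlow f} = {f | IsShipment N.link (fun i => (N.supply i : ℝ))
      (fun j => (N.demand j : ℝ)) f} := by
    ext f
    exact ⟨fun h => ⟨h.1, h.2, h.3, h.4⟩, fun h => ⟨h.1, h.2, h.3, h.4⟩⟩
  rw [this]
  exact isCompact_isShipment _ _ _

theorem isCompact_maxFlowPolytope (N : BipartiteNetwork S D) : IsCompact N.maxFlowPolytope := by
  by_cases h : ∃ f₀, N.IsMaxFlow f₀
  · obtain ⟨f₀, hf₀⟩ := h
    have : N.maxFlowPolytope = {f | N.IsFlow f} ∩ {f | flowValue f₀ ≤ flowValue f} := by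
      ext f
      exact ⟨fun h => ⟨h.1, h.2 _ hf₀.1⟩, fun h => ⟨h.1, fun g hg => (hf₀.2 g hg).trans h.2⟩⟩
    rw [this]
    refine N.isCompact_isFlow.inter_right (isClosed_le continuous_const ?_)
    unfold flowValue outflow
    fun_prop
  · push Not at h
    have : N.maxFlowPolytope = ∅ := Set.eq_empty_of_forall_notMem h
    rw [this]
    exact isCompact_empty

theorem IsFlow.convex (N : BipartiteNetwork S D) : Convex ℝ {f | N.IsFlow f} := by
  intro f hf g hg s t hs ht hst
  refine ⟨fun i j => ?_, fun i j hij => ?_, fun i => ?_, fun j => ?_⟩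
  · have := hf.nonneg i j
    have := hg.nonneg i j
    simp only [Pi.add_apply, Pi.smul_apply, smul_eq_mul]
    positivity
  · simp [hf.eq_zero i j hij, hg.eq_zero i j hij]
  · have h : outflow (s • f + t • g) i = s * outflow f i + t * outflow g i := by
      simp [outflow, Finset.sum_add_distrib, Finset.mul_sum]
    rw [h]
    exact convex_Iic (N.supply i : ℝ) (hf.outflow_le i) (hg.outflow_le i) hs ht hst
  · have h : inflow (s • f + t • g) j = s * inflow f j + t * inflow g j := by
      simp [inflow, Finset.sum_add_distrib, Finset.mul_sum]
    rw [h]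
    exact convex_Iic (N.demand j : ℝ) (hf.inflow_le j) (hg.inflow_le j) hs ht hst

theorem convex_maxFlowPolytope (N : BipartiteNetwork S D) : Convex ℝ N.maxFlowPolytope := by
  intro f hf g hg s t hs ht hst
  refine ⟨IsFlow.convex N hf.1 hg.1 hs ht hst, fun k hk => ?_⟩
  rw [flowValue_add, flowValue_smul, flowValue_smul]
  have h1 := mul_le_mul_of_nonneg_left (hf.2 k hk) hs
  have h2 := mul_le_mul_of_nonneg_left (hg.2 k hk) ht
  calc flowValue k = s * flowValue k + t * flowValue k := by rw [← add_mul, hst, one_mul]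
    _ ≤ _ := add_le_add h1 h2

/-- Every maximum flow is a convex combination of integral extreme points. -/
theorem IsMaxFlow.exists_weights {f : S → D → ℝ} (hf : N.IsMaxFlow f) :
    ∃ w : N.ExtremeFlow → ℝ, (∀ F, 0 ≤ w F) ∧ ∑ F, w F = 1 ∧
      ∀ i j, ∑ F, w F * toReal F.1 i j = f i j := by
  have hrange : Set.extremePoints ℝ N.maxFlowPolytope
      = Set.range fun F : N.ExtremeFlow => toReal F.1 := by
    ext g
    constructor
    · intro hg
      obtain ⟨F, rfl⟩ := exists_toReal_of_mem_extremePoints hg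
      exact ⟨⟨F, hg⟩, rfl⟩
    · rintro ⟨F, rfl⟩
      exact F.2
  have hmem : f ∈ convexHull ℝ (Set.range fun F : N.ExtremeFlow => toReal F.1) := by
    -- Krein–Milman; the closure is superfluous because there are finitely many extreme points.
    have hcl := closure_convexHull_extremePoints N.isCompact_maxFlowPolytope
      N.convex_maxFlowPolytope
    rw [hrange, ((Set.finite_range _).isClosed_convexHull (𝕜 := ℝ)).closure_eq] at hcl
    rw [hcl]
    exact hf
  rw [convexHull_range_eq_exists_affineCombination] at hmem
  obtain ⟨s, w, hw0, hw1, hw⟩ := hmem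
  rw [Finset.affineCombination_eq_linear_combination _ _ _ hw1] at hw
  refine ⟨fun F => if F ∈ s then w F else 0, fun F => ?_, ?_, fun i j => ?_⟩
  · dsimp only
    split_ifs with h
    exacts [hw0 F h, le_rfl]
  · simpa using hw1
  · rw [← hw]
    simp [Finset.sum_apply]

end BipartiteNetwork

theorem LinearProgram.exists_isOptimal {m n : Type*} [Fintype n] (L : LinearProgram m n)
    {K : Set (n → ℝ)} (hK : IsCompact K) (hsub : ∀ x, L.IsFeasible x → x ∈ K)
    (hne : ∃ x, L.IsFeasible x) : ∃ x, L.IsOptimal x := by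
  have hclosed : IsClosed {x | L.IsFeasible x} := by
    have : {x | L.IsFeasible x} = {x | L.A.mulVec x = L.rhs} ∩ ⋂ k, {x : n → ℝ | 0 ≤ x k} := by
      ext x
      simp only [LinearProgram.IsFeasible, Set.mem_ofPred_eq, Set.mem_inter_iff, Set.mem_iInter]
    rw [this]
    refine IsClosed.inter (isClosed_eq ?_ continuous_const)
      (isClosed_iInter fun k => isClosed_le continuous_const (continuous_apply k))
    exact continuous_const.matrix_mulVec continuous_id
  have hcont : Continuous fun x : n → ℝ => L.cost ⬝ᵥ x := continuous_const.dotProduct continuous_id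
  obtain ⟨x, hx, hmin⟩ := (hK.of_isClosed_subset hclosed hsub).exists_isMinOn hne
    hcont.continuousOn
  exact ⟨x, hx, fun y hy => hmin hy⟩

namespace BipartiteNetwork

variable {S D : Type*} [Fintype S] [Fintype D] {N : BipartiteNetwork S D}

theorem isFeasible_decompositionLP {f : S → D → ℝ} {c w : N.ExtremeFlow → ℝ} :
    (N.decompositionLP f c).IsFeasible w ↔
      (∀ F, 0 ≤ w F) ∧ ∑ F, w F = 1 ∧ ∀ i j, ∑ F, w F * toReal F.1 i j = f i j := by
  unfold LinearProgram.IsFeasible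
  rw [and_comm]
  refine and_congr_right fun _ => ?_
  rw [funext_iff, Option.forall]
  refine and_congr ?_ ?_
  · simp [decompositionLP, Matrix.mulVec, dotProduct]
  · simp [decompositionLP, Matrix.mulVec, dotProduct, mul_comm]

theorem IsMaxFlow.exists_isOptimal {f : S → D → ℝ} (hf : N.IsMaxFlow f) (c : N.ExtremeFlow → ℝ) :
    ∃ w, (N.decompositionLP f c).IsOptimal w := by
  obtain ⟨w, hw⟩ := hf.exists_weights
  refine LinearProgram.exists_isOptimal _ (isCompact_stdSimplex ℝ N.ExtremeFlow) (fun x hx => ?_)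
    ⟨w, isFeasible_decompositionLP.mpr hw⟩
  obtain ⟨h0, h1, -⟩ := isFeasible_decompositionLP.mp hx
  exact ⟨h0, h1⟩

end BipartiteNetwork

end Integrality

/-! ### From maximum b-matchings to flows and back, and the induced lottery -/

section Correspondence

open scoped Classical

namespace BMatching

variable {V : Type*} [Fintype V] {G : SimpleGraph V} {b : V → ℕ} {μ : V → V → ℕ}

noncomputable instance (G : SimpleGraph V) (b : V → ℕ) : Fintype (UComponent G b) :=
  Fintype.ofFinite _

theorem sum_sinkNode {M : Type*} [AddCommMonoid M] (h : SinkNode G b → M) :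
    ∑ k, h k = ∑ k, h (.inl k) + (∑ j, h (.inr (.inl j)) + ∑ C, h (.inr (.inr C))) := by
  rw [← Fintype.sum_sum_type (fun k => h (.inr k)), ← Fintype.sum_sum_type h]
  exact Finset.sum_congr (by ext; simp) fun _ _ => rfl

theorem sum_dite_subtype {M : Type*} [AddCommMonoid M] {p : V → Prop}
    [Fintype {j // p j}] (f : {j // p j} → M) :
    ∑ j, (if h : p j then f ⟨j, h⟩ else 0) = ∑ j, f j := by
  have h1 := Finset.sum_subtype (Finset.univ.filter p) (p := p) (F := inferInstance) (by simp)
    (fun j => if h : p j then f ⟨j, h⟩ else 0)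
  rw [Finset.sum_filter] at h1
  refine Eq.trans (Finset.sum_congr rfl fun j _ => ?_)
    (h1.trans (Finset.sum_congr rfl fun j _ => dif_pos j.2))
  split_ifs <;> rfl

/-- The flow on the transformed network that is read off from a maximum b-matching. -/
noncomputable def flowOf (μ : V → V → ℕ) (i : V) : SinkNode G b → ℕ
  | .inl k => if i = k then b i else 0
  | .inr (.inl j) => if i ∈ underdemanded G b then μ i j else 0
  | .inr (.inr C) =>
    if i ∈ componentSet C.1 then utility (restrict (underdemanded G b) μ) i else 0

theorem sum_subtype_ite_eq {V : Type*} (p : V → Prop) [Fintype {k // p k}] (i : V) [Decidable (p i)]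
    (c : ℕ) : ∑ k : {k // p k}, (if i = k then c else 0) = if p i then c else 0 := by
  split_ifs with h
  · rw [Finset.sum_eq_single ⟨i, h⟩ (fun k _ hk => if_neg fun h => hk (Subtype.ext h.symm))
      (fun h => absurd (Finset.mem_univ _) h), if_pos rfl]
  · exact Finset.sum_eq_zero fun k _ => if_neg fun hk => h (by rw [hk]; exact k.2)

/-- An underdemanded agent has neighbours only in its own component and among the overdemanded
agents, so no unit is lost. The other agents are saturated. -/
theorem IsMaxBMatching.sum_flowOf (hμ : IsMaxBMatching G b μ) (i : V) :
    ∑ k : SinkNode G b, flowOf μ i k = utility μ i := by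
  rw [sum_sinkNode]
  simp only [flowOf]
  rw [sum_subtype_ite_eq (· ∉ underdemanded G b)]
  by_cases hi : i ∈ underdemanded G b
  · have hO : ∑ j : {j // j ∈ overdemanded G b}, μ i j
        = ∑ j, if j ∈ overdemanded G b then μ i j else 0 := by
      rw [← sum_dite_subtype]
      rfl
    have hC : ∑ C : {C : UComponent G b // C.supp.Nontrivial ∧ Odd (componentDemand C)},
        (if i ∈ componentSet C.1 then utility (restrict (underdemanded G b) μ) i else 0)
        = utility (restrict (underdemanded G b) μ) i := by
      -- A component without a node is harmless: an exchange with another underdemanded agent makes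
      -- the component nontrivial, hence odd.
      by_cases h0 : utility (restrict (underdemanded G b) μ) i = 0
      · simp [h0]
      obtain ⟨j, -, hj⟩ := Finset.exists_ne_zero_of_sum_ne_zero h0
      have hjU : j ∈ underdemanded G b := by
        by_contra hjU
        exact hj (if_neg fun h => hjU h.2)
      rw [restrict, if_pos ⟨hi, hjU⟩] at hj
      have hadj := hμ.1.isEdgeArray.adj (Nat.pos_of_ne_zero hj)
      set C := (G.induce (underdemanded G b)).connectedComponentMk ⟨i, hi⟩
      have hiC : i ∈ componentSet C := ⟨hi, rfl⟩
      have hnt : C.supp.Nontrivial :=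
        ⟨⟨i, hi⟩, rfl, ⟨j, hjU⟩, (mem_componentSet_of_adj hiC hjU hadj).2,
          fun h => hadj.ne (congrArg Subtype.val h)⟩
      rw [Finset.sum_eq_single ⟨C, hnt, odd_componentDemand hnt⟩ (fun C' _ hC' => if_neg fun h =>
        hC' (Subtype.ext h.2.symm)) (fun h => absurd (Finset.mem_univ _) h), if_pos hiC]
    rw [hC]
    simp only [hi, if_true, not_true_eq_false, if_false, zero_add]
    rw [hO]
    unfold utility
    rw [← Finset.sum_add_distrib]
    refine Finset.sum_congr rfl fun j _ => ?_
    unfold restrict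
    by_cases hjU : j ∈ underdemanded G b
    · simp [hi, hjU, overdemanded]
    · by_cases hjO : j ∈ overdemanded G b
      · simp [hjU, hjO]
      · have : μ i j = 0 := hμ.1.eq_zero i j fun h => hjO ⟨hjU, i, hi, h.symm⟩
        simp [this]
  · have hC : ∀ C : UComponent G b, i ∉ componentSet C := fun C h => hi h.1
    simp [hi, hC, hμ.utility_eq hi]

theorem IsMaxBMatching.sum_flowOf_left (hμ : IsMaxBMatching G b μ) (k : SinkNode G b) :
    ∑ i, flowOf μ i k = (transformedNetwork G b).demand k := by
  rcases k with k | j | C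
  · simp [flowOf, transformedNetwork]
  · simp only [flowOf, transformedNetwork]
    rw [← hμ.utility_eq j.2.1]
    refine Finset.sum_congr rfl fun i _ => ?_
    split_ifs with hi
    · exact hμ.1.symm _ _
    · exact (hμ.eq_zero_of_overdemanded j.2 hi).symm
  · simp only [flowOf, transformedNetwork]
    rw [← Finset.sum_filter]
    exact hμ.sum_utility_componentSet C.2.1

theorem IsMaxBMatching.isFlow_flowOf (hμ : IsMaxBMatching G b μ) :
    (transformedNetwork G b).IsFlow (BipartiteNetwork.toReal (flowOf μ)) := by
  refine ⟨fun i k => Nat.cast_nonneg _, fun i k hik => ?_, fun i => ?_, fun k => ?_⟩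
  · rw [BipartiteNetwork.toReal, Nat.cast_eq_zero]
    rcases k with k | j | C
    · exact if_neg hik
    · have : i ∈ underdemanded G b → μ i j = 0 := fun hi =>
        hμ.1.eq_zero i j fun h => hik ⟨hi, h⟩
      simpa [flowOf] using this
    · exact if_neg hik
  · simp only [BipartiteNetwork.outflow, BipartiteNetwork.toReal]
    rw [← Nat.cast_sum, hμ.sum_flowOf]
    exact_mod_cast hμ.1.utility_le i
  · simp only [BipartiteNetwork.inflow, BipartiteNetwork.toReal]
    rw [← Nat.cast_sum, hμ.sum_flowOf_left]

/-- Total demand is thus the size of a maximum b-matching; this certifies maximality of the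
b-matching built from a flow. -/
theorem IsMaxBMatching.sum_utility (hμ : IsMaxBMatching G b μ) :
    ∑ i, utility μ i = ∑ k, (transformedNetwork G b).demand k := by
  rw [← Finset.sum_congr rfl fun i _ => hμ.sum_flowOf i, Finset.sum_comm]
  exact Finset.sum_congr rfl fun k _ => hμ.sum_flowOf_left k

/-- A maximum flow on the transformed network meets every demand. -/
theorem inflow_eq_demand {F : V → SinkNode G b → ℕ}
    (hF : (transformedNetwork G b).IsMaxFlow (BipartiteNetwork.toReal F)) (k : SinkNode G b) :
    ∑ i, F i k = (transformedNetwork G b).demand k := by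
  have hle : ∀ k, ∑ i, F i k ≤ (transformedNetwork G b).demand k := fun k => by
    have := hF.1.inflow_le k
    simp only [BipartiteNetwork.inflow, BipartiteNetwork.toReal] at this
    exact_mod_cast this
  obtain ⟨μ, hμ⟩ := exists_isMaxBMatching G b
  have hmax := hF.2 _ hμ.isFlow_flowOf
  simp only [BipartiteNetwork.flowValue, BipartiteNetwork.outflow, BipartiteNetwork.toReal] at hmax
  have hmax' : ∑ i, ∑ k : SinkNode G b, flowOf μ i k ≤ ∑ i, ∑ k, F i k := by exact_mod_cast hmax
  rw [Finset.sum_comm, Finset.sum_congr rfl fun k _ => hμ.sum_flowOf_left k,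
    Finset.sum_comm] at hmax'
  exact (Finset.sum_eq_sum_iff_of_le fun k _ => hle k).mp
    (le_antisymm (Finset.sum_le_sum fun k _ => hle k) hmax') k (Finset.mem_univ k)

theorem exists_unit_of_sum_add_one {s : Finset V} {p q : V → ℕ} (hpq : ∀ i ∈ s, p i ≤ q i)
    (h : ∑ i ∈ s, p i + 1 = ∑ i ∈ s, q i) : ∃ i₀ ∈ s, ∀ i ∈ s, p i + unit i₀ i = q i := by
  obtain ⟨i₀, hi₀, hlt⟩ : ∃ i₀ ∈ s, p i₀ < q i₀ := by
    by_contra! hc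
    have := Finset.sum_le_sum hc
    omega
  refine ⟨i₀, hi₀, (Finset.sum_eq_sum_iff_of_le fun i hi => ?_).mp ?_⟩
  · have := hpq i hi
    rcases unit_eq_one_or i₀ i with ⟨rfl, h5⟩ | ⟨-, h5⟩ <;> omega
  · rw [Finset.sum_add_distrib, ← h]
    congr 1
    have := sum_unit_filter i₀ (· ∈ s)
    rw [if_pos hi₀] at this
    rw [← this]
    exact Finset.sum_congr (by ext; simp) fun _ _ => rfl

/-- The flow into the node of a component is realised by a b-matching inside that component. -/
theorem exists_component_array {F : V → SinkNode G b → ℕ}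
    (hF : (transformedNetwork G b).IsMaxFlow (BipartiteNetwork.toReal F))
    (C : {C : UComponent G b // C.supp.Nontrivial ∧ Odd (componentDemand C)}) :
    ∃ κ, IsEdgeArray G κ ∧
      (∀ i j, ¬ (i ∈ componentSet C.1 ∧ j ∈ componentSet C.1) → κ i j = 0) ∧
      ∀ i, utility κ i = F i (.inr (.inr C)) := by
  have hz : ∀ i ∉ componentSet C.1, F i (.inr (.inr C)) = 0 := fun i hi => by
    have := hF.1.eq_zero i (.inr (.inr C)) hi
    rwa [BipartiteNetwork.toReal, Nat.cast_eq_zero] at this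
  have hsum : ∑ i with i ∈ componentSet C.1, F i (.inr (.inr C)) + 1
      = ∑ i with i ∈ componentSet C.1, b i := by
    have h1 := inflow_eq_demand hF (.inr (.inr C))
    rw [← componentDemand_eq, Finset.sum_filter_of_ne fun i _ h => not_not.mp fun hi => h (hz i hi),
      h1]
    -- The truncated subtraction in the demand is exact because an odd number is positive.
    exact Nat.sub_add_cancel C.2.2.pos
  obtain ⟨i₀, hi₀, hu⟩ := exists_unit_of_sum_add_one (q := b)
    (fun i _ => (transformedNetwork G b).toReal_le_supply (hF.1.outflow_le i) _) hsum
  obtain ⟨κ, hκ, hκz, hκu⟩ := exists_near_perfect C.2.1 (Finset.mem_filter.mp hi₀).2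
  refine ⟨κ, hκ, hκz, fun i => ?_⟩
  by_cases hi : i ∈ componentSet C.1
  · have h1 := hu i (Finset.mem_filter.mpr ⟨Finset.mem_univ i, hi⟩)
    have h2 := hκu i hi
    omega
  · rw [hz i hi]
    exact Finset.sum_eq_zero fun j _ => hκz i j fun h => hi h.1

/-- Every integral maximum flow on the transformed network corresponds to a maximum b-matching. -/
theorem exists_corresponds {F : V → SinkNode G b → ℕ}
    (hF : (transformedNetwork G b).IsMaxFlow (BipartiteNetwork.toReal F)) :
    ∃ μ, IsMaxBMatching G b μ ∧ Corresponds F μ := by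
  obtain ⟨μ₀, hμ₀⟩ := exists_isMaxBMatching G b
  choose κ hκ hκz hκu using exists_component_array hF
  have hz : ∀ i k, ¬ (transformedNetwork G b).link i k → F i k = 0 := fun i k hik => by
    have := hF.1.eq_zero i k hik
    rwa [BipartiteNetwork.toReal, Nat.cast_eq_zero] at this
  have hin := inflow_eq_demand hF
  let A : V → V → ℕ := fun i j => if h : j ∈ overdemanded G b then F i (.inr (.inl ⟨j, h⟩)) else 0
  have hAadj : ∀ i j, ¬ G.Adj i j → A i j = 0 := by
    intro i j hij
    simp only [A]
    split_ifs with h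
    · exact hz _ _ fun hl => hij hl.2
    · rfl
  have hA : IsEdgeArray G fun i j => A i j + A j i :=
    ⟨fun i j => add_comm _ _, fun i j hij => by
      simp only [hAadj i j hij, hAadj j i fun h => hij h.symm]⟩
  let W : Set V := {i | i ∉ underdemanded G b ∧ i ∉ overdemanded G b}
  -- Component nodes give exchanges inside components, and `A` those between underdemanded and
  -- overdemanded agents. The arcs of agents in `W` carry no information on partners, so these are
  -- copied from `μ₀`.
  let μ : V → V → ℕ := fun i j => (∑ C, κ C i j + (A i j + A j i)) + restrict W μ₀ i j
  have hμ : IsEdgeArray G μ :=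
    ((IsEdgeArray.sum hκ).add hA).add (hμ₀.1.isEdgeArray.isEdgeArray_restrict W)
  have hAin : ∀ i, ∑ j, A j i = if i ∈ overdemanded G b then b i else 0 := by
    intro i
    simp only [A]
    split_ifs with h
    · exact hin (.inr (.inl ⟨i, h⟩))
    · simp
  have hinl : ∀ i, ∑ k, F i (.inl k) = if i ∉ underdemanded G b then b i else 0 := by
    intro i
    refine Eq.trans (Finset.sum_congr rfl fun k _ => ?_)
      (sum_subtype_ite_eq (· ∉ underdemanded G b) i (b i))
    split_ifs with h
    · subst h
      rw [← Finset.sum_eq_single (f := fun i => F i (.inl k)) k.1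
        (fun i _ hi => hz i _ hi) fun h => absurd (Finset.mem_univ _) h]
      exact hin (.inl k)
    · exact hz _ _ h
  -- Agents in `W` have no underdemanded neighbour and exchange nothing with overdemanded ones under
  -- `μ₀`, so restricting to `W` loses nothing.
  have hrest : ∀ i ∈ W, utility (restrict W μ₀) i = b i := by
    intro i hi
    rw [← hμ₀.utility_eq hi.1]
    refine Finset.sum_congr rfl fun j _ => ?_
    unfold restrict
    split_ifs with h
    · rfl
    · by_cases hjU : j ∈ underdemanded G b
      · exact (hμ₀.1.eq_zero i j fun hadj => hi.2 ⟨hi.1, j, hjU, hadj⟩).symm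
      · have hjO : j ∈ overdemanded G b := by
          by_contra hjO
          exact h ⟨hi, hjU, hjO⟩
        rw [hμ₀.1.symm]
        exact (hμ₀.eq_zero_of_overdemanded hjO hi.1).symm
  have hu : ∀ i, utility μ i = ∑ k, F i k := by
    intro i
    have h1 : utility μ i = ∑ C, utility (κ C) i + (∑ j, A i j + ∑ j, A j i)
        + utility (restrict W μ₀) i := by
      simp only [μ, utility, Finset.sum_add_distrib]
      congr 2
      exact Finset.sum_comm
    have h2 : ∑ j, A i j = ∑ j, F i (.inr (.inl j)) :=
      sum_dite_subtype fun j : {j // j ∈ overdemanded G b} => F i (.inr (.inl j))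
    rw [h1, sum_sinkNode, h2, hAin, hinl, Finset.sum_congr rfl fun C _ => hκu C i]
    by_cases hiU : i ∈ underdemanded G b
    · have hiO : i ∉ overdemanded G b := fun h => h.1 hiU
      rw [utility_restrict_of_notMem fun h => h.1 hiU]
      rw [if_neg hiO, if_neg (not_not.mpr hiU)]
      ring
    · by_cases hiO : i ∈ overdemanded G b
      · rw [utility_restrict_of_notMem fun h => h.2 hiO]
        rw [if_pos hiO, if_pos hiU]
        ring
      · rw [hrest i ⟨hiU, hiO⟩]
        rw [if_neg hiO, if_pos hiU]
        ring
  have hout : ∀ i, ∑ k, F i k ≤ b i := fun i => by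
    have := hF.1.outflow_le i
    simp only [BipartiteNetwork.outflow, BipartiteNetwork.toReal] at this
    exact_mod_cast this
  refine ⟨μ, hμ₀.of_sum_le (hμ.isBMatching fun i => (hu i).trans_le (hout i)) ?_, hu,
    fun i hi j => ?_⟩
  · rw [hμ₀.sum_utility, Finset.sum_congr rfl fun i _ => hu i, Finset.sum_comm,
      Finset.sum_congr rfl fun k _ => hin k]
  · have h1 : ∑ C, κ C i j = 0 := Finset.sum_eq_zero fun C _ => hκz C i j fun h => j.2.1 h.2.1
    have h2 : A j i = 0 := dif_neg fun h => h.1 hi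
    have h3 : restrict W μ₀ i j = 0 := if_neg fun h => h.1.1 hi
    simp only [μ, h1, h2, h3, A, dif_pos j.2, Subtype.coe_eta]
    omega

theorem isLottery_inducedLottery {m : (transformedNetwork G b).ExtremeFlow → MaxBMatching G b}
    {w : (transformedNetwork G b).ExtremeFlow → ℝ} (h0 : ∀ F, 0 ≤ w F) (h1 : ∑ F, w F = 1) :
    IsLottery (inducedLottery m w) := by
  refine ⟨fun μ => Finset.sum_nonneg fun F _ => h0 F, ?_⟩
  unfold inducedLottery
  rw [← h1]
  exact Finset.sum_fiberwise _ _ _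

/-- Several extreme flows may share one b-matching; grouping them by the fibres of `m` reduces the
claim to linearity. -/
theorem lotteryUtility_inducedLottery
    {m : (transformedNetwork G b).ExtremeFlow → MaxBMatching G b}
    {w : (transformedNetwork G b).ExtremeFlow → ℝ} (hm : ∀ F, Corresponds F.1 (m F).1)
    {f : V → SinkNode G b → ℝ} (hf : ∀ i k, f i k = ∑ F, w F * (F.1 i k : ℝ)) (i : V) :
    lotteryUtility (inducedLottery m w) i = BipartiteNetwork.outflow f i := by
  have h1 : ∀ μ, inducedLottery m w μ * (utility μ.1 i : ℝ)
      = ∑ F with m F = μ, w F * (utility (m F).1 i : ℝ) := by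
    intro μ
    unfold inducedLottery
    rw [Finset.sum_mul]
    exact Finset.sum_congr rfl fun F hF => by rw [(Finset.mem_filter.mp hF).2]
  unfold lotteryUtility BipartiteNetwork.outflow
  rw [Finset.sum_congr rfl fun μ _ => h1 μ, Finset.sum_fiberwise]
  simp only [hf]
  rw [Finset.sum_comm]
  refine Finset.sum_congr rfl fun F _ => ?_
  rw [(hm F).utility_eq, Nat.cast_sum, Finset.mul_sum]

end BMatching

end Correspondence

theorem mainTheorem2 {V : Type*} [Fintype V] (G : SimpleGraph V) (b : V → ℕ)
    (hb : ∀ i, 0 < b i) :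
    (∃! x : V → ℝ, (BMatching.transformedNetwork G b).IsEgalitarianAllocation x) ∧
    (∃ f : V → BMatching.SinkNode G b → ℝ,
      (BMatching.transformedNetwork G b).IsEgalitarianMaxFlow f) ∧
    (∀ g ∈ Set.extremePoints ℝ (BMatching.transformedNetwork G b).maxFlowPolytope,
      ∃ F : V → BMatching.SinkNode G b → ℕ, g = BipartiteNetwork.toReal F) ∧
    (∀ F : V → BMatching.SinkNode G b → ℕ,
      (BMatching.transformedNetwork G b).IsMaxFlow (BipartiteNetwork.toReal F) →
      ∃ μ, BMatching.IsMaxBMatching G b μ ∧ BMatching.Corresponds F μ) ∧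
    (∀ f : V → BMatching.SinkNode G b → ℝ,
      (BMatching.transformedNetwork G b).IsEgalitarianMaxFlow f →
      ∀ c : (BMatching.transformedNetwork G b).ExtremeFlow → ℝ,
      (∃ w, ((BMatching.transformedNetwork G b).decompositionLP f c).IsOptimal w) ∧
      ∀ w, ((BMatching.transformedNetwork G b).decompositionLP f c).IsOptimal w →
        (∀ F, 0 ≤ w F) ∧ ∑ F, w F = 1 ∧
        (∀ i k, f i k = ∑ F, w F * (F.1 i k : ℝ)) ∧
        (∃ m : (BMatching.transformedNetwork G b).ExtremeFlow → BMatching.MaxBMatching G b,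
          ∀ F, BMatching.Corresponds F.1 (m F).1) ∧
        ∀ m : (BMatching.transformedNetwork G b).ExtremeFlow → BMatching.MaxBMatching G b,
          (∀ F, BMatching.Corresponds F.1 (m F).1) →
          BMatching.IsLottery (BMatching.inducedLottery m w) ∧
          ∀ i, BMatching.lotteryUtility (BMatching.inducedLottery m w) i =
            BipartiteNetwork.outflow f i) := by
  refine ⟨BipartiteNetwork.existsUnique_isEgalitarianAllocation _,
    BipartiteNetwork.exists_isEgalitarianMaxFlow _,
    fun g hg => BipartiteNetwork.exists_toReal_of_mem_extremePoints hg,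
    fun F hF => BMatching.exists_corresponds hF,
    fun f hf c => ⟨hf.1.exists_isOptimal c, fun w hw => ?_⟩⟩
  obtain ⟨h0, h1, h2⟩ := BipartiteNetwork.isFeasible_decompositionLP.mp hw.1
  have h2' : ∀ i k, f i k = ∑ F, w F * (F.1 i k : ℝ) := fun i k => (h2 i k).symm
  refine ⟨h0, h1, h2', ?_, fun m hm => ⟨BMatching.isLottery_inducedLottery h0 h1,
    BMatching.lotteryUtility_inducedLottery hm h2'⟩⟩
  choose μ hμ hc using fun F : (BMatching.transformedNetwork G b).ExtremeFlow =>
    BMatching.exists_corresponds F.2.1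
  exact ⟨fun F => ⟨μ F, hμ F⟩, hc⟩
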